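/- Let $n\ge 4$ and let $W$ be the Weyl group of type $D_n$ with simple reflections $s_1,\dots,s_n$ (the Dynkin diagram has the edges $a - (a+1)$ for $1\le a\le n-2$, and the edge $(n-2) - n$), with its Bruhat order $<$. **Boxes.** Let $Q$ be the staircase of boxes drawn in French notation: its rows, from bottom to top, have $1,2,\dots,n-1$ boxes and are left-justified. For boxes $x,y$ put $x\le y$ if $x$ is weakly southwest of $y$. The last boxes of the $n-1$ rows are the diagonal boxes; the distance of a box from the diagonal is the number of boxes of $Q$ below it in its column. Each box $b$ carries a simple reflection $s_b$: the diagonal boxes carry $s_n,s_{n-1},s_n,\dots$, alternating from the bottom left, and a box at distance $d\ge 1$ carries $s_{n-1-d}$. "Left/right of" means in the same row, "above/below" means in the same column; compass directions do not imply this. **Diagrams.** For a convex set $C\subseteq Q$, an $\oplus$-diagram $D$ of shape $C$ is a filling of the boxes of $C$ with $0$ and $+$. A reading order $b_1,\dots,b_m$ is a linear extension of $C$; it gives the word $s_{b_m}\cdots s_{b_1}$ and the subexpression $\mathbf v(D)$ obtained by replacing $s_b$ by $1$ for every $b$ containing $+$. Let $v(D)\in W$ be the product of $\mathbf v(D)$;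 it does not depend on the reading order. A subexpression $\mathbf v$ of a reduced word $s_{i_1}\cdots s_{i_m}$ is positive distinguished if $v_{(j-1)}<v_{(j-1)}s_{i_j}$ for all $j$, where $v_{(j)}$ is the product of the first $j$ factors of $\mathbf v$. Let $O\subseteq Q$ be a lower order ideal. An $\oplus$-diagram $D$ of shape $O$ is a Le-diagram if $\mathbf v(D)$ is positive distinguished. The Le-ification of $D$ is the unique Le-diagram $D_+$ of shape $O$ with $v(D_+)=v(D)$. **Moves.** A Le-move is a triple $(x,y,S)$ of boxes $x<y$ and a filling $S:(x,y)\to\{0,+,?\}$ of the open interval such that $v(D\cup x)=v(D\cup y)$ for every $\oplus$-diagram $D$ of shape $(x,y)$ that agrees with $S$ wherever $S\ne\,?$; here $D\cup x$ (of shape $[x,y)$) and $D\cup y$ (of shape $(x,y]$) have a $0$ added in $x$, respectively in $y$. It can be performed on a diagram $D$ whose shape contains $[x,y]$ if $D(y)=0$ and $D|_{(x,y)}$ agrees with $S$ wherever $S\neq\,?$; the result is obtained from $D$ by putting $+$ in $y$ and switching the entry of $x$. A set of Le-moves is complete if every $\oplus$-diagram whose shape is a lower order ideal of $Q$ is taken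 to its Le-ification by a finite sequence of moves in the set. Consider the following triples. * $(x,y,S_0)$, for $x<y$ such that $[x,y]$ is a rectangle with at least two rows and two columns: $S_0$ is $+$ in the top left and bottom right corners of $[x,y]$ and $0$ elsewhere. * For $S_1$ and $S_2$: let $x<y$, let $x$ be $r$ rows south of $y$, let $y$ have distance $d$ from the diagonal, and assume $k:=r-(d+1)>0$. * $(x,y,S_1)$: $S_1$ is $+$ in the box $z_1$ that is $k$ boxes to the left of $y$ and in the box $z_2$ that is $k$ boxes above $x$; it is $?$ in the box that is below $z_1$ and to the right of $z_2$, and in the boxes strictly west of $z_1$ and strictly north of $z_2$; it is $0$ elsewhere. * $(x,y,S_2)$, one for each choice of a row $\rho$ strictly south of $z_1$ and strictly north of $z_2$, where $z_1$ is the box $k$ boxes to the left of $y$ and $z_2$ is the box below $z_1$ that is $k$ rows north of $x$: with $z_4$ and $z_3$ the boxes of row $\rho$ in the columns of $z_1$ and of $x$, $S_2$ is $+$ in $z_1,z_2,z_3,z_4$; it is $?$ in the boxes strictly west of $z_1$ and strictly north of $z_3$, and in the boxes strictly between $z_2$ and $z_4$ in their column; it is $0$ elsewhere. **Theorem.** (A)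 For every lower order ideal $O\subseteq Q$ and every reading order of $O$, an $\oplus$-diagram $D$ of shape $O$ has $\mathbf v(D)$ positive distinguished (that is, $D$ is a Le-diagram) if and only if 1. whenever a box containing $0$ is above a box containing $+$, all boxes to the left of that $0$ contain $0$; 2. whenever a box containing $0$, at distance $d$ from the diagonal, is to the right of a box $b$ containing $+$, there is no $+$ strictly southwest of $b$ and $d+1$ rows south of the $0$; 3. there are no box $c$ containing $0$, at distance $d$ from the diagonal, and boxes $b_1,b_2,b_3$ containing $+$ such that $c$ is to the right of $b_1$, $b_2$ is the box $d+1$ rows below $b_1$, and $b_3$ is strictly northwest of $b_2$ and strictly south of $b_1$. (B) All the triples $(x,y,S_0)$, $(x,y,S_1)$, $(x,y,S_2)$ are Le-moves, and together they form a complete set of Le-moves. -/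

import Mathlib

namespace LeD

/-! ### Coxeter groups: Bruhat order and positive distinguished subexpressions -/

section Coxeter

variable {B W : Type*} [Group W] {M : CoxeterMatrix B}

/-- `u → v` in the Bruhat graph: `v = u t` for a reflection `t`, and the length goes up. -/
def BruhatStep (cs : CoxeterSystem M W) (u v : W) : Prop :=
  ∃ t : W, cs.IsReflection t ∧ v = u * t ∧ cs.length u < cs.length v

/-- The strict Bruhat order of a Coxeter group. -/
def BruhatLT (cs : CoxeterSystem M W) : W → W → Prop :=
  Relation.TransGen (BruhatStep cs)

/-- A subexpression of a word `s_{i₁} ⋯ s_{iₘ}` is written as the list of the pairs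
`(i_k, present?)`; the letters marked `false` are replaced by `1`.  This is its product. -/
def subexprProd (cs : CoxeterSystem M W) (ω : List (B × Bool)) : W :=
  (ω.map fun p => if p.2 = true then cs.simple p.1 else 1).prod

/-- Positive distinguished subexpressions of a reduced word:
`v₍ⱼ₋₁₎ < v₍ⱼ₋₁₎ s_{iⱼ}` for all `j`, where `v₍ⱼ₎` is the product of the first `j` factors. -/
structure IsPDS (cs : CoxeterSystem M W) (ω : List (B × Bool)) : Prop where
  reduced : cs.IsReduced (ω.map Prod.fst)
  lt_mul_simple : ∀ (k : ℕ) (hk : k < ω.length),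
    BruhatLT cs (subexprProd cs (ω.take k)) (subexprProd cs (ω.take k) * cs.simple (ω[k]).1)

end Coxeter

/-! ### The Weyl group of type `Dₙ`

The simple label `a ∈ {1, …, n}` is the element `a - 1` of `Fin n`.  The Dynkin diagram has the
edges `a — a + 1` for `a + 1 ≤ n - 1`, and the edge `n - 2 — n`. (Mathlib's `CoxeterMatrix.D` also
joins `n - 1` and `n`, so it is not used.) -/

/-- `i — j` is an edge of the Dynkin diagram of type `Dₙ`, with `i < j`. -/
def DEdge (n : ℕ) (i j : Fin n) : Prop :=
  ((i : ℕ) + 1 = j ∧ (j : ℕ) + 1 < n) ∨ ((i : ℕ) + 2 = j ∧ (j : ℕ) + 1 = n)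

instance (n : ℕ) (i j : Fin n) : Decidable (DEdge n i j) := by
  unfold DEdge; infer_instance

/-- The Coxeter matrix of type `Dₙ`. -/
def typeD (n : ℕ) : CoxeterMatrix (Fin n) where
  M := Matrix.of fun i j : Fin n =>
    if i = j then 1 else if DEdge n i j ∨ DEdge n j i then 3 else 2
  isSymm := by
    refine Matrix.IsSymm.ext fun i j => ?_
    simp only [Matrix.of_apply, eq_comm (a := j) (b := i), or_comm (a := DEdge n j i)]
  diagonal := by simp
  off_diagonal := by
    intro i j h
    simp only [Matrix.of_apply, if_neg h]
    split_ifs <;> decide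

/-! ### The poset of boxes of type `(Dₙ, n)` -/

/-- The boxes of the staircase (French notation).  Rows are counted from the bottom and columns
from the left, both from `0`; the box in row `r` and column `c` exists iff `c ≤ r < n - 1`.
The order inherited from the product order (`x ≤ y` iff `x` is weakly southwest of `y`) is the
transitive closure of "immediately to the left of or immediately below". -/
abbrev Box (n : ℕ) : Type := {p : Fin (n - 1) × Fin (n - 1) // p.2 ≤ p.1}

namespace Box

variable {n : ℕ}

/-- The row of a box, counted from the bottom (north is up). -/
def row (b : Box n) : ℕ := b.1.1

/-- The column of a box, counted from the left. -/
def col (b : Box n) : ℕ := b.1.2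

/-- The distance from the diagonal: the number of boxes below `b` in its column, which are the
boxes in rows `col b, …, row b - 1`. -/
def dist (b : Box n) : ℕ := b.row - b.col

/-- The simple label of a box.  On the diagonal the labels alternate `n, n - 1, n, …` from the
bottom left; off the diagonal the label is `n - 1 - dist b` (so the top row reads
`1, 2, …, n - 2` from the left, before its diagonal box). -/
def label (b : Box n) : Fin n :=
  if b.dist = 0 then
    if Even b.col then ⟨n - 1, by have := b.1.1.isLt; omega⟩
    else ⟨n - 2, by have := b.1.1.isLt; omega⟩
  else ⟨n - 2 - b.dist, by have := b.1.1.isLt; omega⟩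

end Box

/-! ### Diagrams, reading orders, Le-diagrams -/

/-- The two symbols `0` and `+`. -/
inductive Entry where
  | zero : Entry
  | plus : Entry

/-- The other symbol. -/
def Entry.switch : Entry → Entry
  | Entry.zero => Entry.plus
  | Entry.plus => Entry.zero

/-- Is the symbol a `0`? -/
def Entry.isZero : Entry → Bool
  | Entry.zero => true
  | Entry.plus => false

/-- A filling of boxes by `0` and `+`.  An ⊕-diagram of shape `C` is given by a filling of which
only the values on `C` are used. -/
abbrev Filling (n : ℕ) : Type := Box n → Entry

/-- `e` is a linear extension of `C`: it lists the boxes of `C` once each, and no box is listed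
before a smaller one. -/
structure IsReadingOrder {n : ℕ} (C : Set (Box n)) (e : List (Box n)) : Prop where
  nodup : e.Nodup
  mem_iff : ∀ b, b ∈ e ↔ b ∈ C
  linear : e.Pairwise fun a b => ¬ b < a

/-- The subexpression `𝐯(D)` of the word of the reading order `e`.  The word is written down from
right to left, and the generator of a box is present iff the box contains a `0`. -/
def subexpr {n : ℕ} (e : List (Box n)) (D : Filling n) : List (Fin n × Bool) :=
  e.reverse.map fun b => (b.label, (D b).isZero)

/-- The row reading order of all boxes: rows from bottom to top, each from left to right. -/
def rowOrder (n : ℕ) : List (Box n) :=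
  (List.finRange (n - 1)).flatMap fun r =>
    (List.finRange (n - 1)).filterMap fun c =>
      if h : c ≤ r then some ⟨(r, c), h⟩ else none

open Classical in
/-- The row reading order of a set of boxes. -/
noncomputable def rowReading {n : ℕ} (C : Set (Box n)) : List (Box n) :=
  (rowOrder n).filter fun b => decide (b ∈ C)

lemma mem_rowOrder {n : ℕ} (b : Box n) : b ∈ rowOrder n := by
  obtain ⟨⟨r, c⟩, h⟩ := b
  simp only [rowOrder, List.mem_flatMap, List.mem_filterMap, List.mem_finRange, true_and]
  exact ⟨r, c, by simpa using h⟩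

lemma pairwise_rowOrder (n : ℕ) :
    (rowOrder n).Pairwise fun a b => a.1.1 < b.1.1 ∨ (a.1.1 = b.1.1 ∧ a.1.2 < b.1.2) := by
  have hf : (List.finRange (n - 1)).Pairwise (· < ·) := List.pairwise_lt_finRange _
  unfold rowOrder
  rw [List.pairwise_flatMap]
  refine ⟨fun r _ => ?_, ?_⟩
  · rw [List.pairwise_filterMap]
    refine hf.imp ?_
    intro c c' hcc b hb b' hb'
    split_ifs at hb hb' with h h'
    simp only [Option.some.injEq] at hb hb'
    subst hb hb'
    exact Or.inr ⟨rfl, hcc⟩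
  · refine hf.imp ?_
    intro r r' hrr b hb b' hb'
    simp only [List.mem_filterMap, List.mem_finRange, true_and] at hb hb'
    obtain ⟨c, hc⟩ := hb
    obtain ⟨c', hc'⟩ := hb'
    split_ifs at hc hc' with h h'
    simp only [Option.some.injEq] at hc hc'
    subst hc hc'
    exact Or.inl hrr

/-- The row reading order is a reading order. -/
lemma isReadingOrder_rowReading {n : ℕ} (C : Set (Box n)) : IsReadingOrder C (rowReading C) where
  nodup := by
    refine List.Nodup.filter _ ((pairwise_rowOrder n).imp ?_)
    rintro a b h rfl
    rcases h with h | h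
    · exact lt_irrefl _ h
    · exact lt_irrefl _ h.2
  mem_iff b := by simp [rowReading, mem_rowOrder]
  linear := by
    refine ((pairwise_rowOrder n).imp ?_).filter _
    intro a b h hlt
    have h1 : b.1.1 ≤ a.1.1 ∧ b.1.2 ≤ a.1.2 := hlt.le
    rcases h with h | h
    · exact absurd h1.1 (not_le.mpr h)
    · exact absurd h1.2 (not_le.mpr h.2)

section Diagrams

variable {n : ℕ} {W : Type*} [Group W]

/-- The element `v(D)` of a diagram `D` of shape `C` (a convex set of boxes); it does not depend
on the reading order, and the row reading order is used. -/
noncomputable def elt (cs : CoxeterSystem (typeD n) W) (C : Set (Box n)) (D : Filling n) : W :=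
  subexprProd cs (subexpr (rowReading C) D)

/-- `D` is a Le-diagram of shape `O`: `𝐯(D)` is a positive distinguished subexpression, whatever
the reading order. -/
def IsLeDiagram (cs : CoxeterSystem (typeD n) W) (O : Set (Box n)) (D : Filling n) : Prop :=
  ∀ e, IsReadingOrder O e → IsPDS cs (subexpr e D)

/-- `E` is the Le-ification of the diagram `D` of shape `O`: the one and only Le-diagram of shape
`O` with `v(E) = v(D)`. -/
def IsLeification (cs : CoxeterSystem (typeD n) W) (O : Set (Box n)) (D E : Filling n) : Prop :=
  (IsLeDiagram cs O E ∧ elt cs O E = elt cs O D) ∧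
    ∀ E' : Filling n, IsLeDiagram cs O E' ∧ elt cs O E' = elt cs O D → Set.EqOn E' E O

/-- The three conditions on an ⊕-diagram `D` of shape `O`. -/
structure LeConditions (O : Set (Box n)) (D : Filling n) : Prop where
  /-- If there is a `0` (in `c`) above a `+` (in `a`), all boxes to the left of `c` contain `0`. -/
  cond₁ : ∀ c ∈ O, ∀ a ∈ O, D c = Entry.zero → D a = Entry.plus →
    a.col = c.col → a.row < c.row →
    ∀ b ∈ O, b.row = c.row → b.col < c.col → D b = Entry.zero
  /-- If there is a `0` (in `c`) at distance `d` from the diagonal to the right of a `+` in `b`,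
  there is no `+` strictly southwest of `b` and `d + 1` rows south of `c`. -/
  cond₂ : ∀ c ∈ O, ∀ b ∈ O, D c = Entry.zero → D b = Entry.plus →
    b.row = c.row → b.col < c.col →
    ¬ ∃ a ∈ O, D a = Entry.plus ∧ a.row < b.row ∧ a.col < b.col ∧ a.row + (c.dist + 1) = c.row
  /-- There is no `0` (in `c`) at distance `d` from the diagonal to the right of a `+` in `b₁`
  such that the box `b₂` that is `d + 1` rows below `b₁` contains a `+` and some `b₃` strictly
  northwest of `b₂` and strictly south of `b₁` contains a `+`. -/
  cond₃ : ¬ ∃ c ∈ O, ∃ b₁ ∈ O, ∃ b₂ ∈ O, ∃ b₃ ∈ O,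
    D c = Entry.zero ∧ D b₁ = Entry.plus ∧ D b₂ = Entry.plus ∧ D b₃ = Entry.plus ∧
    (b₁.row = c.row ∧ b₁.col < c.col) ∧
    (b₂.col = b₁.col ∧ b₂.row + (c.dist + 1) = b₁.row) ∧
    (b₂.row < b₃.row ∧ b₃.col < b₂.col) ∧ b₃.row < b₁.row

/-! ### Le-moves -/

/-- A `{0, +, ?}`-filling; `?` is `none`.  As for diagrams, only the values on the boxes in
question are used. -/
abbrev PartialFilling (n : ℕ) : Type := Box n → Option Entry

/-- The diagram `D` of shape `C` is compatible with `S`. -/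
def Compatible (C : Set (Box n)) (D : Filling n) (S : PartialFilling n) : Prop :=
  ∀ z ∈ C, S z = none ∨ S z = some (D z)

/-- A triple `(x, y, S)`: two boxes and a `{0, +, ?}`-filling of the open interval `(x, y)`. -/
structure Triple (n : ℕ) where
  x : Box n
  y : Box n
  S : PartialFilling n

/-- `(x, y, S)` is a Le-move: `x < y` and `v(D ∪ x) = v(D ∪ y)` for all `D` of shape `(x, y)`
that are compatible with `S`, where `D ∪ x` has shape `[x, y)` and a `0` in `x`, and `D ∪ y` has
shape `(x, y]` and a `0` in `y`. -/
def IsLeMove (cs : CoxeterSystem (typeD n) W) (m : Triple n) : Prop :=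
  m.x < m.y ∧ ∀ D : Filling n, Compatible (Set.Ioo m.x m.y) D m.S →
    elt cs (Set.Ico m.x m.y) (Function.update D m.x Entry.zero) =
      elt cs (Set.Ioc m.x m.y) (Function.update D m.y Entry.zero)

/-- The move `m` can be performed on the diagram `D` of shape `O`, with result `D'`. -/
def Performs (O : Set (Box n)) (m : Triple n) (D D' : Filling n) : Prop :=
  Set.Icc m.x m.y ⊆ O ∧ D m.y = Entry.zero ∧ Compatible (Set.Ioo m.x m.y) D m.S ∧
    D' = Function.update (Function.update D m.y Entry.plus) m.x (D m.x).switch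

/-- `D'` is obtained from the diagram `D` of shape `O` by a finite sequence of moves in `F`. -/
def Reaches (F : Set (Triple n)) (O : Set (Box n)) : Filling n → Filling n → Prop :=
  Relation.ReflTransGen fun D D' => ∃ m ∈ F, Performs O m D D'

/-- `F` is a complete system of Le-moves: every member is a Le-move, and every ⊕-diagram, of any
order ideal as shape, is taken to its Le-ification by a finite sequence of moves in `F`. -/
def IsCompleteSystem (cs : CoxeterSystem (typeD n) W) (F : Set (Triple n)) : Prop :=
  (∀ m ∈ F, IsLeMove cs m) ∧
    ∀ O : Set (Box n), IsLowerSet O → ∀ D : Filling n,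
      ∃ E : Filling n, IsLeification cs O D E ∧ Reaches F O D E

/-! ### The three families of moves -/

/-- `+` in the top left and the bottom right corner of the rectangle `[x, y]`, `0` elsewhere. -/
def filling₀ (x y : Box n) : PartialFilling n := fun z =>
  if (z.row = y.row ∧ z.col = x.col) ∨ (z.row = x.row ∧ z.col = y.col) then some Entry.plus
  else some Entry.zero

/-- The rectangular moves.  The interval `[x, y]` is a rectangle with at least two rows and two
columns; it is a rectangle iff the staircase contains its bottom right corner. -/
def moves₀ (n : ℕ) : Set (Triple n) :=
  {m | m.x.row < m.y.row ∧ m.x.col < m.y.col ∧ m.y.col ≤ m.x.row ∧ m.S = filling₀ m.x m.y}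

/-- The filling `S₁`: a `+` in the row of `y`, `k` boxes to the left of `y`; a `+` in the column of
`x`, `k` boxes above `x`; a `?` in the box below the first and to the right of the second `+`, and
in the boxes strictly west of the first and strictly north of the second `+`; `0` elsewhere. -/
def filling₁ (x y : Box n) (k : ℕ) : PartialFilling n := fun z =>
  if z.row = y.row ∧ z.col + k = y.col then some Entry.plus
  else if z.col = x.col ∧ z.row = x.row + k then some Entry.plus
  else if z.col + k = y.col ∧ z.row = x.row + k then none
  else if z.col + k < y.col ∧ x.row + k < z.row then none
  else some Entry.zero

/-- The second family: `x < y`, `x` is `r` rows south of `y`, `y` is at distance `d` from the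
diagonal, `r > d + 1` and `k = r - (d + 1)`. -/
def moves₁ (n : ℕ) : Set (Triple n) :=
  {m | m.x < m.y ∧ ∃ k : ℕ, 0 < k ∧ m.y.row = m.x.row + (k + (m.y.dist + 1)) ∧
    m.S = filling₁ m.x m.y k}

/-- The filling `S₂`: a `+` (`z₁`) in the row of `y`, `k` boxes to the left of `y`; a `+` (`z₂`) in
the column of `z₁`, `k` rows north of `x`; in the row `ρ`, a `+` (`z₄`) in the column of `z₁` and a
`+` (`z₃`) in the column of `x`; a `?` in the boxes strictly west of `z₁` and strictly north of
`z₃`, and in the boxes strictly between `z₂` and `z₄`; `0` elsewhere. -/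
def filling₂ (x y : Box n) (k ρ : ℕ) : PartialFilling n := fun z =>
  if z.col + k = y.col ∧ (z.row = y.row ∨ z.row = ρ ∨ z.row = x.row + k) then some Entry.plus
  else if z.col = x.col ∧ z.row = ρ then some Entry.plus
  else if z.col + k < y.col ∧ ρ < z.row then none
  else if z.col + k = y.col ∧ x.row + k < z.row ∧ z.row < ρ then none
  else some Entry.zero

/-- The third family: `x`, `y` and `k` as in the second family, and `ρ` any row strictly south of
`z₁` and strictly north of `z₂`. -/
def moves₂ (n : ℕ) : Set (Triple n) :=
  {m | m.x < m.y ∧ ∃ k ρ : ℕ, 0 < k ∧ m.y.row = m.x.row + (k + (m.y.dist + 1)) ∧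
    m.x.row + k < ρ ∧ ρ < m.y.row ∧ m.S = filling₂ m.x m.y k ρ}

end Diagrams

end LeD

/-!
The proof rests on a change of coordinates.  For `0 ≤ h < n`, let the *hook* `h` consist of column
`h` and of row `h - 1`.  Two hooks `i < j` meet in exactly one box, and every box arises in this
way, so a diagram is a set of pairs `i < j` (those with a `+`).  When every box contains `0`, a wire
of the wiring diagram of the word runs straight along a hook; its sign changes when it passes from
the row to the column of the hook.  Hence, in the reflection representation on `ℤⁿ`, the product over
the boxes that precede a box takes the root `e_i + e_j` of its pair of hooks to the simple root of
its label (`IsLowerReading.rep_boxRoot`).  In a general diagram, a wire that reaches a `+` in the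
box of the hooks `i` and `j` turns from one of them into the other, and changes sign relative to the
hooks (`IsLowerReading.rep_pipe`).  So the product over the boxes between `x` and `y` takes the
simple root of `x` to that of `y` if and only if the two pipes that leave `x` meet again at `y`,
each after an odd number of turns (`IsLowerReading.rep_eq_simpleRoot_iff`).

The group theory that is needed about `W` is that the reflection representation is faithful and that
`ℓ(w sᵢ) > ℓ(w)` if and only if `w` takes the `i`-th simple root to a positive root
(`height_rep_simpleRoot_pos`), which has an elementary proof for a simply laced diagram.

Everything else is about pipes.
* Under the three conditions two pipes never meet again in this way at a `0`
  (`IsLowerReading.not_meet`), so no letter of `𝐯(D)` is a descent, and `𝐯(D)` is positive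
  distinguished (`LeConditions.isPDS`); the filling by `0`s gives that the word is reduced.
* For the fillings `S₀`, `S₁`, `S₂` the pipes from `x` do meet again at `y`, so the triples are
  Le-moves (`pipesMeet_of_mem_allMoves`, `isLeMove_of_mem_allMoves`).
* If a condition fails, then at a minimal `0` where it fails a move can be performed
  (`exists_move`).

A move shifts a `0` down or removes two of them, so every diagram is taken by moves to one that
satisfies the conditions, and hence is a Le-diagram with the same product.  As a positive
distinguished subexpression is determined by its product (`IsPDS.eq_of_prod_eq`), this is the
Le-ification.  For the same reason a Le-diagram that violated a condition would agree with one that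
satisfies the conditions, which is absurd; so the conditions are necessary, too.
-/

namespace LeD

/-! ### The reflection representation -/

/-- The `k`-th coordinate vector of `ℤⁿ`; it is `0` if `k ≥ n`. -/
def basisVec (n k : ℕ) : Fin n → ℤ := fun m => if (m : ℕ) = k then 1 else 0

/-- The linear functional `e_k ↦ k`, as a vector: it takes the value `1` on every simple root,
so that its sign tells the positive from the negative roots. -/
def heightVec (n : ℕ) : Fin n → ℤ := fun m => (m : ℕ)

/-- The simple root of a label: `e₀ + e₁` for the last label, and `e_{k+1} - e_k` for the label
`n - 2 - k` in `Fin n`. -/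
def simpleRoot (n : ℕ) (i : Fin n) : Fin n → ℤ :=
  if (i : ℕ) + 1 = n then basisVec n 0 + basisVec n 1
  else basisVec n (n - 1 - i) - basisVec n (n - 2 - i)

lemma basisVec_dotProduct {n a : ℕ} (ha : a < n) (v : Fin n → ℤ) :
    basisVec n a ⬝ᵥ v = v ⟨a, ha⟩ := by
  have h : basisVec n a = Pi.single (⟨a, ha⟩ : Fin n) (1 : ℤ) := by
    funext m
    simp [basisVec, Pi.single_apply, Fin.ext_iff]
  rw [h, single_one_dotProduct]

lemma basisVec_dotProduct_basisVec {n a : ℕ} (ha : a < n) (b : ℕ) :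
    basisVec n a ⬝ᵥ basisVec n b = if a = b then 1 else 0 := by
  rw [basisVec_dotProduct ha]
  rfl

lemma basisVec_dotProduct_heightVec {n a : ℕ} (ha : a < n) :
    basisVec n a ⬝ᵥ heightVec n = a := by
  rw [basisVec_dotProduct ha]
  rfl

lemma simpleRoot_dotProduct_heightVec {n : ℕ} (hn : 2 ≤ n) (i : Fin n) :
    simpleRoot n i ⬝ᵥ heightVec n = 1 := by
  have hi := i.isLt
  unfold simpleRoot
  split_ifs with h
  · rw [add_dotProduct, basisVec_dotProduct_heightVec (by omega),
      basisVec_dotProduct_heightVec (by omega)]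
    norm_num
  · rw [sub_dotProduct, basisVec_dotProduct_heightVec (by omega),
      basisVec_dotProduct_heightVec (by omega)]
    omega

lemma simpleRoot_dotProduct_simpleRoot {n : ℕ} (hn : 3 ≤ n) (i j : Fin n) :
    simpleRoot n i ⬝ᵥ simpleRoot n j =
      if i = j then 2 else if DEdge n i j ∨ DEdge n j i then -1 else 0 := by
  have hi := i.isLt
  have hj := j.isLt
  have e0 : ∀ b, basisVec n 0 ⬝ᵥ basisVec n b = if 0 = b then 1 else 0 :=
    basisVec_dotProduct_basisVec (by omega)
  have e1 : ∀ b, basisVec n 1 ⬝ᵥ basisVec n b = if 1 = b then 1 else 0 :=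
    basisVec_dotProduct_basisVec (by omega)
  have e2 : ∀ b, basisVec n (n - 1 - i) ⬝ᵥ basisVec n b = if n - 1 - i = b then 1 else 0 :=
    basisVec_dotProduct_basisVec (by omega)
  have e3 : ∀ b, basisVec n (n - 2 - i) ⬝ᵥ basisVec n b = if n - 2 - i = b then 1 else 0 :=
    basisVec_dotProduct_basisVec (by omega)
  by_cases hij : i = j
  · subst hij
    rw [if_pos rfl]
    unfold simpleRoot
    split_ifs <;>
      simp only [add_dotProduct, dotProduct_add, sub_dotProduct, dotProduct_sub, e0, e1, e2, e3] <;>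
      split_ifs <;> first | (exfalso; omega) | norm_num
  rw [if_neg hij]
  have hij' : (i : ℕ) ≠ j := fun h => hij (Fin.ext h)
  by_cases hE : DEdge n i j ∨ DEdge n j i
  · rw [if_pos hE]
    unfold DEdge at hE
    unfold simpleRoot
    split_ifs <;>
      simp only [add_dotProduct, dotProduct_add, sub_dotProduct, dotProduct_sub, e0, e1, e2, e3] <;>
      split_ifs <;> first | (exfalso; omega) | norm_num
  · rw [if_neg hE]
    unfold DEdge at hE
    unfold simpleRoot
    split_ifs <;>
      simp only [add_dotProduct, dotProduct_add, sub_dotProduct, dotProduct_sub, e0, e1, e2, e3] <;>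
      split_ifs <;> first | (exfalso; omega) | norm_num

lemma simpleRoot_dotProduct_self {n : ℕ} (hn : 3 ≤ n) (i : Fin n) :
    simpleRoot n i ⬝ᵥ simpleRoot n i = 2 := by
  rw [simpleRoot_dotProduct_simpleRoot hn, if_pos rfl]

/-- The reflection `v ↦ v - ⟨v, a⟩ a` in a vector `a` of norm `2`. -/
def refl {n : ℕ} (a : Fin n → ℤ) : Module.End ℤ (Fin n → ℤ) where
  toFun v := v - (v ⬝ᵥ a) • a
  map_add' v w := by rw [add_dotProduct, add_smul]; abel
  map_smul' c v := by
    rw [smul_dotProduct, RingHom.id_apply, smul_sub, smul_assoc]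

lemma refl_apply {n : ℕ} (a v : Fin n → ℤ) : refl a v = v - (v ⬝ᵥ a) • a := rfl

lemma refl_mul_self {n : ℕ} {a : Fin n → ℤ} (ha : a ⬝ᵥ a = 2) : refl a * refl a = 1 := by
  refine LinearMap.ext fun v => ?_
  ext m
  simp only [Module.End.mul_apply, refl_apply, Module.End.one_apply, sub_dotProduct,
    smul_dotProduct, ha, Pi.sub_apply, Pi.smul_apply, smul_eq_mul]
  ring

lemma refl_dotProduct_refl {n : ℕ} {a : Fin n → ℤ} (ha : a ⬝ᵥ a = 2) (v w : Fin n → ℤ) :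
    refl a v ⬝ᵥ refl a w = v ⬝ᵥ w := by
  simp only [refl_apply, sub_dotProduct, dotProduct_sub, smul_dotProduct, dotProduct_smul, ha,
    smul_eq_mul, dotProduct_comm a w]
  ring

lemma isLiftable_refl {n : ℕ} (hn : 3 ≤ n) :
    (typeD n).IsLiftable fun i => refl (simpleRoot n i) := by
  intro i j
  have hii := simpleRoot_dotProduct_self hn i
  have hjj := simpleRoot_dotProduct_self hn j
  have hij := simpleRoot_dotProduct_simpleRoot hn i j
  have hji : simpleRoot n j ⬝ᵥ simpleRoot n i = simpleRoot n i ⬝ᵥ simpleRoot n j :=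
    dotProduct_comm _ _
  have hM : (typeD n).M i j = if i = j then 1 else if DEdge n i j ∨ DEdge n j i then 3 else 2 := rfl
  rw [hM]
  split_ifs at hij ⊢ with h1 h2
  · subst h1
    rw [pow_one, refl_mul_self hii]
  · rw [hij] at hji
    simp only [pow_succ, pow_zero, one_mul]
    refine LinearMap.ext fun v => ?_
    ext m
    simp only [Module.End.mul_apply, refl_apply, Module.End.one_apply, sub_dotProduct,
      smul_dotProduct, hii, hjj, hij, hji, Pi.sub_apply, Pi.smul_apply, smul_eq_mul]
    ring
  · rw [hij] at hji
    simp only [pow_succ, pow_zero, one_mul]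
    refine LinearMap.ext fun v => ?_
    ext m
    simp only [Module.End.mul_apply, refl_apply, Module.End.one_apply, sub_dotProduct,
      smul_dotProduct, hii, hjj, hij, hji, Pi.sub_apply, Pi.smul_apply, smul_eq_mul]
    ring

section Representation

variable {n : ℕ} {W : Type*} [Group W]

/-- The reflection representation of the Weyl group on `ℤⁿ`. -/
def rep (hn : 3 ≤ n) (cs : CoxeterSystem (typeD n) W) : W →* Module.End ℤ (Fin n → ℤ) :=
  cs.lift ⟨fun i => refl (simpleRoot n i), isLiftable_refl hn⟩

variable (hn : 3 ≤ n) (cs : CoxeterSystem (typeD n) W)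

lemma rep_simple (i : Fin n) : rep hn cs (cs.simple i) = refl (simpleRoot n i) :=
  cs.lift_apply_simple (isLiftable_refl hn) i

lemma rep_simple_apply (i : Fin n) (v : Fin n → ℤ) :
    rep hn cs (cs.simple i) v = v - (v ⬝ᵥ simpleRoot n i) • simpleRoot n i := by
  rw [rep_simple, refl_apply]

lemma rep_mul_apply (u w : W) (v : Fin n → ℤ) :
    rep hn cs (u * w) v = rep hn cs u (rep hn cs w v) := by
  rw [map_mul, Module.End.mul_apply]

lemma rep_simple_simpleRoot (i : Fin n) :
    rep hn cs (cs.simple i) (simpleRoot n i) = -simpleRoot n i := by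
  rw [rep_simple_apply, simpleRoot_dotProduct_self hn]
  module

lemma rep_dotProduct_rep (w : W) (u v : Fin n → ℤ) :
    rep hn cs w u ⬝ᵥ rep hn cs w v = u ⬝ᵥ v := by
  induction w using cs.simple_induction_left with
  | one => simp
  | mul_simple_left w i ih =>
    rw [rep_mul_apply, rep_mul_apply, rep_simple,
      refl_dotProduct_refl (simpleRoot_dotProduct_self hn i), ih]

lemma rep_injective (w : W) : Function.Injective (rep hn cs w) := by
  intro u v h
  have h2 := congrArg (rep hn cs w⁻¹) h
  simpa [← rep_mul_apply] using h2

lemma rep_apply_refl (w : W) (a v : Fin n → ℤ) :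
    rep hn cs w (refl a v) = refl (rep hn cs w a) (rep hn cs w v) := by
  rw [refl_apply, refl_apply, map_sub, map_smul, rep_dotProduct_rep]

/-- If the length goes up from `w` to `w sᵢ`, then `w` takes the `i`-th simple root to a positive
root.  Induction on the length: for a right descent `t` of `w`, the root is rewritten in terms of
one of the shorter elements `w t`, `w t s` of the coset of the dihedral group `⟨s, t⟩`. -/
lemma height_rep_simpleRoot_pos (w : W) (i : Fin n)
    (hi : cs.length w < cs.length (w * cs.simple i)) :
    0 < rep hn cs w (simpleRoot n i) ⬝ᵥ heightVec n := by
  induction hl : cs.length w using Nat.strong_induction_on generalizing w i with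
  | _ l ih =>
  subst hl
  by_cases hw : w = 1
  · subst hw
    rw [map_one, Module.End.one_apply, simpleRoot_dotProduct_heightVec (by omega)]
    norm_num
  obtain ⟨j, hj⟩ := cs.exists_rightDescent_of_ne_one hw
  have hj' := cs.isRightDescent_iff.1 hj
  have hij : i ≠ j := by
    rintro rfl
    exact absurd hj (by unfold CoxeterSystem.IsRightDescent; omega)
  obtain ⟨u, rfl⟩ : ∃ u, w = u * cs.simple j := ⟨w * cs.simple j, by simp⟩
  rw [cs.simple_mul_simple_cancel_right] at hj'
  have hpair := simpleRoot_dotProduct_simpleRoot hn i j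
  have hM : (typeD n).M i j = if i = j then 1 else if DEdge n i j ∨ DEdge n j i then 3 else 2 := rfl
  have hrel := cs.simple_mul_simple_pow i j
  rw [show (typeD n).M i j = _ from hM] at hrel
  rw [rep_mul_apply, rep_simple_apply]
  rw [if_neg hij] at hpair hrel
  split_ifs at hpair hrel with hE
  · -- braid relation: the root is `u (α_s + α_t)`, and if `u = z s` is shorter still, it is `z α_t`
    have hbraid : cs.simple i * cs.simple j * cs.simple i =
        cs.simple j * cs.simple i * cs.simple j := by
      have h : cs.simple i * cs.simple j * cs.simple i *
          (cs.simple j * cs.simple i * cs.simple j) = 1 := by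
        rw [← hrel]; simp only [pow_succ, pow_zero, one_mul, mul_assoc]
      rw [mul_eq_one_iff_eq_inv] at h
      rw [h]; simp [mul_assoc]
    have hjpos := ih (cs.length u) (by omega) u j (by omega) rfl
    rw [hpair, show simpleRoot n i - (-1 : ℤ) • simpleRoot n j = simpleRoot n i + simpleRoot n j by
      module]
    rcases cs.length_mul_simple u i with h | h
    · have hipos := ih (cs.length u) (by omega) u i (by omega) rfl
      rw [map_add, add_dotProduct]
      omega
    · obtain ⟨z, rfl⟩ : ∃ z, u = z * cs.simple i := ⟨u * cs.simple i, by simp⟩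
      rw [cs.simple_mul_simple_cancel_right] at h
      have hz : cs.length z < cs.length (z * cs.simple j) := by
        have h3 : z * cs.simple i * cs.simple j * cs.simple i =
            z * cs.simple j * cs.simple i * cs.simple j := by
          simpa only [mul_assoc] using congrArg (z * ·) hbraid
        rw [h3] at hi
        have h4 := cs.length_mul_simple (z * cs.simple j * cs.simple i) j
        have h5 := cs.length_mul_simple (z * cs.simple j) i
        have h6 := cs.length_mul_simple z j
        omega
      have hzpos := ih (cs.length z) (by omega) z j hz rfl
      rw [rep_mul_apply, map_add, rep_simple_simpleRoot, rep_simple_apply,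
        dotProduct_comm (simpleRoot n j), hpair,
        show -simpleRoot n i + (simpleRoot n j - (-1 : ℤ) • simpleRoot n i) = simpleRoot n j by
          module]
      exact hzpos
  · -- commuting reflections: the root is `u α_s`
    have hcomm : cs.simple i * cs.simple j = cs.simple j * cs.simple i := by
      have h : cs.simple i * cs.simple j * (cs.simple i * cs.simple j) = 1 := by
        rw [← hrel, pow_two]
      rw [mul_eq_one_iff_eq_inv] at h
      rw [h]; simp
    have hu : cs.length u < cs.length (u * cs.simple i) := by
      rw [mul_assoc, ← hcomm, ← mul_assoc] at hi
      have h4 := cs.length_mul_simple (u * cs.simple i) j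
      have h6 := cs.length_mul_simple u i
      omega
    rw [hpair, zero_smul, sub_zero]
    exact ih (cs.length u) (by omega) u i hu rfl

lemma height_rep_simpleRoot_neg (w : W) (i : Fin n)
    (hi : cs.length (w * cs.simple i) < cs.length w) :
    rep hn cs w (simpleRoot n i) ⬝ᵥ heightVec n < 0 := by
  have h := height_rep_simpleRoot_pos hn cs (w * cs.simple i) i (by simpa using hi)
  rw [rep_mul_apply, rep_simple_simpleRoot, map_neg, neg_dotProduct] at h
  omega

lemma height_rep_simpleRoot_ne_zero (w : W) (i : Fin n) :
    rep hn cs w (simpleRoot n i) ⬝ᵥ heightVec n ≠ 0 := by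
  rcases lt_or_gt_of_ne (cs.length_mul_simple_ne w i) with h | h
  · exact (height_rep_simpleRoot_neg hn cs w i h).ne
  · exact (height_rep_simpleRoot_pos hn cs w i h).ne'

lemma length_lt_of_height_pos (w : W) (i : Fin n)
    (h : 0 < rep hn cs w (simpleRoot n i) ⬝ᵥ heightVec n) :
    cs.length w < cs.length (w * cs.simple i) := by
  by_contra hlt
  have hne := cs.length_mul_simple_ne w i
  have := height_rep_simpleRoot_neg hn cs w i (by omega)
  omega

lemma rep_faithful : Function.Injective (rep hn cs) := by
  rw [injective_iff_map_eq_one]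
  intro w hw
  by_contra hne
  obtain ⟨i, hi⟩ := cs.exists_rightDescent_of_ne_one hne
  have h := height_rep_simpleRoot_neg hn cs w i hi
  rw [hw, Module.End.one_apply, simpleRoot_dotProduct_heightVec (by omega)] at h
  omega

lemma mul_simple_eq_of_rep_eq {u : W} {i j : Fin n}
    (h : rep hn cs u (simpleRoot n i) = simpleRoot n j) :
    u * cs.simple i = cs.simple j * u := by
  apply rep_faithful hn cs
  refine LinearMap.ext fun v => ?_
  rw [rep_mul_apply, rep_mul_apply, rep_simple, rep_simple, rep_apply_refl, h]

/-- A simple reflection makes only one positive root negative. -/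
lemma rep_eq_simpleRoot_of_height {w : W} {i j : Fin n}
    (hpos : 0 < rep hn cs w (simpleRoot n i) ⬝ᵥ heightVec n)
    (hneg : ¬ 0 < rep hn cs (cs.simple j * w) (simpleRoot n i) ⬝ᵥ heightVec n) :
    rep hn cs w (simpleRoot n i) = simpleRoot n j := by
  have hne := height_rep_simpleRoot_ne_zero hn cs (cs.simple j * w) i
  rw [rep_mul_apply, rep_simple_apply, sub_dotProduct, smul_dotProduct,
    simpleRoot_dotProduct_heightVec (by omega)] at hneg hne
  have h2 := rep_dotProduct_rep hn cs w (simpleRoot n i) (simpleRoot n i)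
  rw [simpleRoot_dotProduct_self hn] at h2
  have hjj := simpleRoot_dotProduct_self hn j
  set β := rep hn cs w (simpleRoot n i)
  have hsq : (β - simpleRoot n j) ⬝ᵥ (β - simpleRoot n j) = 4 - 2 * (β ⬝ᵥ simpleRoot n j) := by
    rw [sub_dotProduct, dotProduct_sub, dotProduct_sub, dotProduct_comm (simpleRoot n j) β, h2, hjj]
    ring
  have hnn : 0 ≤ (β - simpleRoot n j) ⬝ᵥ (β - simpleRoot n j) :=
    Finset.sum_nonneg fun m _ => mul_self_nonneg _
  rw [smul_eq_mul, mul_one] at hneg hne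
  have h0 : (β - simpleRoot n j) ⬝ᵥ (β - simpleRoot n j) = 0 := by omega
  exact sub_eq_zero.1 (dotProduct_self_eq_zero.1 h0)

end Representation

/-! ### Boxes as pairs of hooks -/

namespace Box

variable {n : ℕ}

/-- The smaller of the two hooks of a box.  For `0 ≤ h < n`, the hook `h` consists of column `h`
and of row `h - 1`; two hooks `i < j` meet in one box, in column `i` and row `j - 1`, and every box
arises in this way from a unique pair. -/
def lo (b : Box n) : ℕ := b.col

/-- The larger of the two hooks of a box. -/
def hi (b : Box n) : ℕ := b.row + 1

lemma lo_lt_hi (b : Box n) : b.lo < b.hi :=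
  Nat.lt_succ_of_le b.2

lemma hi_lt (b : Box n) : b.hi < n := by
  have := b.1.1.isLt
  unfold hi row
  omega

lemma le_iff {a b : Box n} : a ≤ b ↔ a.lo ≤ b.lo ∧ a.hi ≤ b.hi := by
  unfold lo hi row col
  rw [Nat.succ_le_succ_iff, Fin.val_fin_le, Fin.val_fin_le, and_comm]
  rfl

lemma ext_hooks {a b : Box n} (h1 : a.lo = b.lo) (h2 : a.hi = b.hi) : a = b :=
  le_antisymm (le_iff.2 ⟨h1.le, h2.le⟩) (le_iff.2 ⟨h1.ge, h2.ge⟩)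

lemma lt_iff {a b : Box n} :
    a < b ↔ a.lo ≤ b.lo ∧ a.hi ≤ b.hi ∧ (a.lo < b.lo ∨ a.hi < b.hi) := by
  rw [lt_iff_le_not_ge, le_iff, le_iff]
  omega

/-- The box in which the hooks `i < j` meet. -/
def ofHooks (i j : ℕ) (hij : i < j) (hj : j < n) : Box n :=
  ⟨(⟨j - 1, by omega⟩, ⟨i, by omega⟩), by
    rw [Fin.mk_le_mk]; omega⟩

@[simp] lemma lo_ofHooks (i j : ℕ) (hij : i < j) (hj : j < n) : (ofHooks i j hij hj).lo = i := rfl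

@[simp] lemma hi_ofHooks (i j : ℕ) (hij : i < j) (hj : j < n) : (ofHooks i j hij hj).hi = j := by
  change j - 1 + 1 = j
  omega

end Box

/-! ### Reading orders of lower sets -/

/-- The lists of boxes that arise by adding one box at a time to a lower set. -/
inductive IsLowerReading {n : ℕ} : List (Box n) → Prop
  | nil : IsLowerReading []
  | snoc {e : List (Box n)} {b : Box n} (he : IsLowerReading e) (hb : b ∉ e)
      (hlt : ∀ a < b, a ∈ e) : IsLowerReading (e ++ [b])

lemma IsReadingOrder.isLowerReading {n : ℕ} {O : Set (Box n)} (hO : IsLowerSet O)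
    {e e₁ e₂ : List (Box n)} (he : IsReadingOrder O e) (h : e = e₁ ++ e₂) :
    IsLowerReading e₁ := by
  induction e₁ using List.reverseRecOn generalizing e₂ with
  | nil => exact .nil
  | append_singleton e₁ b ih =>
    subst h
    have hnd := he.nodup
    have hlin := he.linear
    refine .snoc (ih (e₂ := b :: e₂) (by simp)) ?_ ?_
    · simp only [List.append_assoc, List.singleton_append] at hnd
      intro hb
      exact (List.nodup_append.1 hnd).2.2 b hb b (by simp) rfl
    · intro a hab
      have hb : b ∈ O := (he.mem_iff b).1 (by simp)
      have ha := (he.mem_iff a).2 (hO hab.le hb)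
      simp only [List.append_assoc, List.singleton_append] at ha hlin
      rw [List.mem_append, List.mem_cons] at ha
      rcases ha with ha | rfl | ha
      · exact ha
      · exact absurd hab (lt_irrefl _)
      · exact absurd hab ((List.pairwise_cons.1 (List.pairwise_append.1 hlin).2.1).1 a ha)

section Products

variable {n : ℕ} {W : Type*} [Group W] (cs : CoxeterSystem (typeD n) W)

/-- The product of the subexpression `𝐯(D)` of the reading order `e`. -/
noncomputable def diagramProd (e : List (Box n)) (D : Filling n) : W :=
  subexprProd cs (subexpr e D)

/-- The factor of a box in `𝐯(D)`. -/
noncomputable def boxFactor (D : Filling n) (b : Box n) : W :=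
  if (D b).isZero = true then cs.simple b.label else 1

@[simp] lemma diagramProd_nil (D : Filling n) : diagramProd cs [] D = 1 := by
  simp [diagramProd, subexpr, subexprProd]

lemma diagramProd_append (e₁ e₂ : List (Box n)) (D : Filling n) :
    diagramProd cs (e₁ ++ e₂) D = diagramProd cs e₂ D * diagramProd cs e₁ D := by
  simp [diagramProd, subexpr, subexprProd]

lemma diagramProd_singleton (b : Box n) (D : Filling n) :
    diagramProd cs [b] D = boxFactor cs D b := by
  simp [diagramProd, subexpr, subexprProd, boxFactor]

lemma diagramProd_cons (b : Box n) (e : List (Box n)) (D : Filling n) :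
    diagramProd cs (b :: e) D = diagramProd cs e D * boxFactor cs D b := by
  rw [← List.singleton_append, diagramProd_append, diagramProd_singleton]

lemma diagramProd_congr {e : List (Box n)} {D D' : Filling n} (h : ∀ b ∈ e, D b = D' b) :
    diagramProd cs e D = diagramProd cs e D' := by
  have : subexpr e D = subexpr e D' := by
    refine List.map_congr_left fun b hb => ?_
    rw [h b (by simpa using hb)]
  rw [diagramProd, this, diagramProd]

lemma boxFactor_zero {D : Filling n} {b : Box n} (h : D b = Entry.zero) :
    boxFactor cs D b = cs.simple b.label := by
  simp [boxFactor, h, Entry.isZero]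

lemma boxFactor_plus {D : Filling n} {b : Box n} (h : D b = Entry.plus) :
    boxFactor cs D b = 1 := by
  simp [boxFactor, h, Entry.isZero]

lemma Entry.eq_zero_or_eq_plus (x : Entry) : x = Entry.zero ∨ x = Entry.plus := by
  cases x
  · exact Or.inl rfl
  · exact Or.inr rfl

lemma Entry.ne_plus_iff {x : Entry} : x ≠ Entry.plus ↔ x = Entry.zero := by
  cases x <;> simp

/-- The filling of all boxes by `0`. -/
def zeroFilling (n : ℕ) : Filling n := fun _ => Entry.zero

/-! ### The action on hooks -/

/-- The image of the `h`-th coordinate vector after the first `c` boxes of the hook `h`, all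
filled with `0`.  The hook runs through its row first, and then up its column.  The sign `(-1) ^ h`
between the two parts accounts for the alternating labels of the diagonal boxes. -/
def hookVec (n h c : ℕ) : Fin n → ℤ :=
  if c < h then basisVec n (h - c)
  else if c = h then (-1 : ℤ) ^ h • basisVec n 0
  else -basisVec n (c - h)

/-- The positive root of a box: the sum of the coordinate vectors of its two hooks. -/
def boxRoot (b : Box n) : Fin n → ℤ := basisVec n b.lo + basisVec n b.hi

lemma simpleRoot_label (b : Box n) :
    simpleRoot n b.label = hookVec n b.lo (b.hi - 1) + hookVec n b.hi b.lo := by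
  have h1 := b.lo_lt_hi
  have h2 := b.hi_lt
  have hd : b.dist = b.hi - 1 - b.lo := rfl
  have hc : b.col = b.lo := rfl
  unfold Box.label
  simp only [hd, hc]
  split_ifs with h3 h4
  · have h5 : b.hi = b.lo + 1 := by omega
    rw [h5]
    simp only [simpleRoot, hookVec]
    rw [if_pos (by omega), if_neg (by omega), if_pos (by omega), if_pos (by omega), h4.neg_one_pow,
      one_smul]
    congr 2
    omega
  · have h5 : b.hi = b.lo + 1 := by omega
    rw [h5]
    simp only [simpleRoot, hookVec]
    rw [if_neg (by omega), if_neg (by omega), if_pos (by omega), if_pos (by omega),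
      (Nat.not_even_iff_odd.1 h4).neg_one_pow, neg_one_smul, neg_add_eq_sub]
    congr 2 <;> omega
  · simp only [simpleRoot, hookVec]
    rw [if_neg (by omega), if_neg (by omega), if_neg (by omega), if_pos (by omega), neg_add_eq_sub]
    congr 2 <;> omega

variable {cs}

/-- `c h` is the number of boxes of the hook `h` in the list `e`, which lists a lower set; the last
field describes the action of the product over `e`, all boxes being filled with `0`. -/
structure HookState (hn : 3 ≤ n) (cs : CoxeterSystem (typeD n) W) (e : List (Box n)) (c : ℕ → ℕ) :
    Prop where
  mem_iff_lo : ∀ b, b ∈ e ↔ b.lo < c b.hi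
  mem_iff_hi : ∀ b, b ∈ e ↔ b.hi ≤ c b.lo
  rep_eq : ∀ h < n, rep hn cs (diagramProd cs e (zeroFilling n)) (basisVec n h) = hookVec n h (c h)

variable {hn : 3 ≤ n}

lemma HookState.eq_of_next {e : List (Box n)} {c : ℕ → ℕ} (hc : HookState hn cs e c) {b : Box n}
    (hb : b ∉ e) (hlt : ∀ a < b, a ∈ e) : c b.hi = b.lo ∧ c b.lo = b.hi - 1 := by
  have h1 := b.lo_lt_hi
  have h2 := b.hi_lt
  have h3 := mt (hc.mem_iff_lo b).2 hb
  have h4 := mt (hc.mem_iff_hi b).2 hb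
  refine ⟨le_antisymm (by omega) ?_, le_antisymm (by omega) ?_⟩
  · by_contra h
    have := (hc.mem_iff_lo _).1 (hlt (Box.ofHooks (b.lo - 1) b.hi (by omega) h2)
      (Box.lt_iff.2 (by simp only [Box.lo_ofHooks, Box.hi_ofHooks]; omega)))
    simp only [Box.lo_ofHooks, Box.hi_ofHooks] at this
    omega
  · by_contra h
    by_cases h5 : b.lo + 1 = b.hi
    · have := (hc.mem_iff_lo _).1 (hlt (Box.ofHooks (b.lo - 1) b.lo (by omega) (by omega))
        (Box.lt_iff.2 (by simp only [Box.lo_ofHooks, Box.hi_ofHooks]; omega)))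
      simp only [Box.lo_ofHooks, Box.hi_ofHooks] at this
      omega
    · have := (hc.mem_iff_hi _).1 (hlt (Box.ofHooks b.lo (b.hi - 1) (by omega) (by omega))
        (Box.lt_iff.2 (by simp only [Box.lo_ofHooks, Box.hi_ofHooks]; omega)))
      simp only [Box.lo_ofHooks, Box.hi_ofHooks] at this
      omega

lemma HookState.rep_boxRoot {e : List (Box n)} {c : ℕ → ℕ} (hc : HookState hn cs e c) {b : Box n}
    (hb : b ∉ e) (hlt : ∀ a < b, a ∈ e) :
    rep hn cs (diagramProd cs e (zeroFilling n)) (boxRoot b) = simpleRoot n b.label := by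
  have h1 := b.lo_lt_hi
  have h2 := b.hi_lt
  obtain ⟨h3, h4⟩ := hc.eq_of_next hb hlt
  rw [boxRoot, map_add, hc.rep_eq _ (h1.trans h2), hc.rep_eq _ h2, h3, h4, simpleRoot_label]

lemma HookState.snoc {e : List (Box n)} {c : ℕ → ℕ} (hc : HookState hn cs e c) {b : Box n}
    (hb : b ∉ e) (hlt : ∀ a < b, a ∈ e) :
    HookState hn cs (e ++ [b])
      (Function.update (Function.update c b.hi (b.lo + 1)) b.lo b.hi) := by
  have h1 := b.lo_lt_hi
  have h2 := b.hi_lt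
  obtain ⟨h3, h4⟩ := hc.eq_of_next hb hlt
  have hroot := hc.rep_boxRoot hb hlt
  have hmem : ∀ z : Box n, z ∈ e ++ [b] ↔ (z ∈ e ∨ (z.lo = b.lo ∧ z.hi = b.hi)) := fun z => by
    rw [List.mem_append, List.mem_singleton]
    exact or_congr_right ⟨fun h => h ▸ ⟨rfl, rfl⟩, fun h => Box.ext_hooks h.1 h.2⟩
  refine ⟨fun z => ?_, fun z => ?_, fun h hh => ?_⟩
  · have hz := z.lo_lt_hi
    rw [hmem, hc.mem_iff_lo]
    simp only [Function.update_apply]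
    split_ifs with h5 h6
    · rw [h5, h4]; omega
    · rw [h6, h3]; omega
    · omega
  · have hz := z.lo_lt_hi
    rw [hmem, hc.mem_iff_hi]
    simp only [Function.update_apply]
    split_ifs with h5 h6
    · rw [h5, h4]; omega
    · rw [h6, h3]; omega
    · omega
  · -- the other hooks are unaffected: their coordinate vectors are orthogonal to the root of `b`
    rw [diagramProd_append, diagramProd_singleton, boxFactor_zero cs rfl, rep_mul_apply,
      rep_simple_apply]
    have hdot : rep hn cs (diagramProd cs e (zeroFilling n)) (basisVec n h) ⬝ᵥ
        simpleRoot n b.label = if h = b.lo ∨ h = b.hi then 1 else 0 := by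
      rw [← hroot, rep_dotProduct_rep, boxRoot, dotProduct_add, basisVec_dotProduct_basisVec hh,
        basisVec_dotProduct_basisVec hh]
      split_ifs <;> first | rfl | omega
    rw [hdot]
    simp only [Function.update_apply]
    rw [boxRoot, map_add, hc.rep_eq _ h2, hc.rep_eq _ (h1.trans h2), h3, h4] at hroot
    rw [hc.rep_eq _ hh]
    by_cases h5 : h = b.lo
    · rw [if_pos (Or.inl h5), if_pos h5, h5, h4, ← hroot, one_smul, sub_add_cancel_left]
      simp only [hookVec]
      rw [if_pos h1, if_neg (by omega), if_neg (by omega)]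
    by_cases h6 : h = b.hi
    · rw [if_pos (Or.inr h6), if_neg h5, if_pos h6, h6, h3, ← hroot, one_smul,
        sub_add_cancel_right]
      simp only [hookVec]
      by_cases h8 : b.lo + 1 < b.hi
      · rw [if_neg (by omega), if_neg (by omega), if_pos h8, neg_neg]
        congr 1
        omega
      · have h9 : b.hi = b.lo + 1 := by omega
        rw [if_neg (by omega), if_pos (by omega), if_neg (by omega), if_pos h9.symm, h9, pow_succ]
        module
    · rw [if_neg (by omega), if_neg h5, if_neg h6, zero_smul, sub_zero]

lemma IsLowerReading.exists_hookState (hn : 3 ≤ n) (cs : CoxeterSystem (typeD n) W)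
    {e : List (Box n)} (he : IsLowerReading e) : ∃ c, HookState hn cs e c := by
  induction he with
  | nil =>
    refine ⟨fun _ => 0, fun b => by simp,
      fun b => by simpa using (b.lo_lt_hi.trans_le' (Nat.zero_le _)).ne', fun h hh => ?_⟩
    rw [diagramProd_nil, map_one, Module.End.one_apply, hookVec]
    split_ifs with h1 h2
    · rfl
    · subst h2; simp
    · omega
  | snoc he hb hlt ih =>
    obtain ⟨c, hc⟩ := ih
    exact ⟨_, hc.snoc hb hlt⟩

/-- The root of a box is taken to the simple root of its label by the product over the boxes that
precede it in a reading order of a lower set. -/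
lemma IsLowerReading.rep_boxRoot (hn : 3 ≤ n) (cs : CoxeterSystem (typeD n) W) {e : List (Box n)}
    {b : Box n} (he : IsLowerReading (e ++ [b])) :
    rep hn cs (diagramProd cs e (zeroFilling n)) (boxRoot b) = simpleRoot n b.label := by
  generalize hl : e ++ [b] = l at he
  cases he with
  | nil => simp at hl
  | snoc he hb hlt =>
    obtain ⟨rfl, h⟩ := List.append_inj' hl rfl
    obtain rfl := List.singleton_inj.1 h
    obtain ⟨c, hc⟩ := he.exists_hookState hn cs
    exact hc.rep_boxRoot hb hlt

end Products

/-! ### Order properties of reading orders -/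

section Order

variable {n : ℕ}

/-- The box lies on the hook `k`. -/
def Box.On (b : Box n) (k : ℕ) : Prop := b.lo = k ∨ b.hi = k

/-- A hook is a chain of boxes. -/
lemma Box.On.le_or_le {a b : Box n} {k : ℕ} (ha : a.On k) (hb : b.On k) : a ≤ b ∨ b ≤ a := by
  have h1 := a.lo_lt_hi
  have h2 := b.lo_lt_hi
  unfold Box.On at ha hb
  rw [Box.le_iff, Box.le_iff]
  omega

lemma IsLowerReading.mem_of_le {e : List (Box n)} (he : IsLowerReading e) {a b : Box n}
    (hb : b ∈ e) (hab : a ≤ b) : a ∈ e := by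
  induction he with
  | nil => simp at hb
  | snoc he hbe hlt ih =>
    rw [List.mem_append, List.mem_singleton] at hb ⊢
    rcases hb with hb | rfl
    · exact Or.inl (ih hb)
    · rcases hab.lt_or_eq with h | h
      · exact Or.inl (hlt a h)
      · exact Or.inr h

lemma IsLowerReading.pairwise {e : List (Box n)} (he : IsLowerReading e) :
    e.Pairwise fun a b => ¬ b ≤ a := by
  induction he with
  | nil => exact List.Pairwise.nil
  | snoc he hbe hlt ih =>
    rw [List.pairwise_append]
    refine ⟨ih, List.pairwise_singleton _ _, fun a ha b hb hle => ?_⟩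
    rw [List.mem_singleton] at hb
    subst hb
    exact hbe (he.mem_of_le ha hle)

lemma IsLowerReading.of_append {e₁ e₂ : List (Box n)} (he : IsLowerReading (e₁ ++ e₂)) :
    IsLowerReading e₁ := by
  induction e₂ using List.reverseRecOn with
  | nil => simpa using he
  | append_singleton e₂ b ih =>
    rw [← List.append_assoc] at he
    generalize hl : e₁ ++ e₂ ++ [b] = l at he
    cases he with
    | nil => simp at hl
    | snoc he hb hlt =>
      obtain ⟨rfl, -⟩ := List.append_inj' hl rfl
      exact ih he

lemma IsLowerReading.mem_between {e₁ L : List (Box n)} {x y z : Box n}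
    (he : IsLowerReading (e₁ ++ x :: L ++ [y])) (hxz : x < z) (hzy : z < y) : z ∈ L := by
  have hz := he.mem_of_le (b := y) (by simp) hzy.le
  have hp := he.pairwise
  rw [List.append_assoc, List.pairwise_append] at hp
  simp only [List.append_assoc, List.cons_append, List.mem_append, List.mem_cons,
    List.not_mem_nil, or_false] at hz
  rcases hz with hz | rfl | hz | rfl
  · exact absurd hxz.le (hp.2.2 z hz x (by simp))
  · exact absurd hxz (lt_irrefl _)
  · exact hz
  · exact absurd hzy (lt_irrefl _)

/-- On a hook, the reading order is the order of boxes. -/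
lemma lt_of_pairwise {l₁ l₂ : List (Box n)} (hp : (l₁ ++ l₂).Pairwise fun a b => ¬ b ≤ a)
    {a b : Box n} {k : ℕ} (ha : a ∈ l₁) (hb : b ∈ l₂) (hak : a.On k) (hbk : b.On k) : a < b := by
  have h := (List.pairwise_append.1 hp).2.2 a ha b hb
  exact lt_of_le_not_ge ((hak.le_or_le hbk).resolve_right h) h

end Order

/-! ### Pipes -/

section Pipes

variable {n : ℕ}

/-- A signed pipe on the hook `s.1`, with sign `s.2`, at the box `b`: if `b` is on the hook and
contains a `+`, the pipe turns into the other hook of `b` and changes its sign. -/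
def pipeStep (D : Filling n) (s : ℕ × ℤ) (b : Box n) : ℕ × ℤ :=
  if (D b).isZero = true then s
  else if s.1 = b.lo then (b.hi, -s.2)
  else if s.1 = b.hi then (b.lo, -s.2)
  else s

/-- The course of a pipe through a list of boxes. -/
def pipe (D : Filling n) (L : List (Box n)) (s : ℕ × ℤ) : ℕ × ℤ := L.foldl (pipeStep D) s

lemma pipe_append (D : Filling n) (L₁ L₂ : List (Box n)) (s : ℕ × ℤ) :
    pipe D (L₁ ++ L₂) s = pipe D L₂ (pipe D L₁ s) := List.foldl_append

lemma pipe_cons (D : Filling n) (b : Box n) (L : List (Box n)) (s : ℕ × ℤ) :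
    pipe D (b :: L) s = pipe D L (pipeStep D s b) := rfl

lemma pipeStep_of_zero {D : Filling n} {b : Box n} (h : D b = Entry.zero) (s : ℕ × ℤ) :
    pipeStep D s b = s := by
  simp [pipeStep, h, Entry.isZero]

lemma pipeStep_of_not_on {D : Filling n} {b : Box n} {s : ℕ × ℤ} (h : ¬ b.On s.1) :
    pipeStep D s b = s := by
  unfold Box.On at h
  unfold pipeStep
  split_ifs <;> first | rfl | omega

lemma pipeStep_turn {D : Filling n} {b : Box n} {k k' : ℕ} {σ : ℤ} (h : D b = Entry.plus)
    (hb : (b.lo = k ∧ b.hi = k') ∨ (b.hi = k ∧ b.lo = k')) :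
    pipeStep D (k, σ) b = (k', -σ) := by
  have := b.lo_lt_hi
  unfold pipeStep
  rw [h, if_neg (by simp [Entry.isZero])]
  rcases hb with ⟨rfl, rfl⟩ | ⟨rfl, rfl⟩
  · simp
  · rw [if_neg (by simp only; omega), if_pos rfl]

lemma pipe_straight {D : Filling n} {L : List (Box n)} {k : ℕ} {σ : ℤ}
    (h : ∀ z ∈ L, z.On k → D z = Entry.zero) : pipe D L (k, σ) = (k, σ) := by
  induction L with
  | nil => rfl
  | cons b L ih =>
    rw [pipe_cons]
    have hb : pipeStep D (k, σ) b = (k, σ) := by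
      by_cases hk : b.On k
      · exact pipeStep_of_zero (h b (by simp) hk) _
      · exact pipeStep_of_not_on hk
    rw [hb]
    exact ih fun z hz => h z (by simp [hz])

/-- The last turn of a pipe that ends on the hook `k`: it exists if the sign has changed, or if
there is a `+` on the hook `k`, since a pipe that was on this hook before would turn away there. -/
lemma exists_last_turn {D : Filling n} {L : List (Box n)} {s : ℕ × ℤ} {k : ℕ} {σ : ℤ}
    (h : pipe D L s = (k, σ)) (hs : s.2 ≠ σ ∨ ∃ b ∈ L, b.On k ∧ D b = Entry.plus) :
    ∃ (L₁ L₂ : List (Box n)) (b : Box n) (k' : ℕ), L = L₁ ++ b :: L₂ ∧ D b = Entry.plus ∧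
      ((b.lo = k ∧ b.hi = k') ∨ (b.hi = k ∧ b.lo = k')) ∧
      (∀ z ∈ L₂, z.On k → D z = Entry.zero) ∧ pipe D L₁ s = (k', -σ) := by
  induction L using List.reverseRecOn with
  | nil =>
    rcases hs with hs | ⟨b, hb, -⟩
    · exact absurd (congrArg Prod.snd h) hs
    · simp at hb
  | append_singleton L c ih =>
    rw [pipe_append, pipe_cons] at h
    change pipeStep D (pipe D L s) c = (k, σ) at h
    by_cases hc : c.On k ∧ D c = Entry.plus
    · refine ⟨L, [], c, (pipe D L s).1, rfl, hc.2, ?_, by simp, ?_⟩ <;>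
      · have hlt := c.lo_lt_hi
        have hck := hc.1
        unfold Box.On at hck
        unfold pipeStep at h
        rw [hc.2, if_neg (by simp [Entry.isZero])] at h
        split_ifs at h with h1 h2
        · rw [Prod.mk.injEq] at h
          first
          | exact Or.inr ⟨h.1, h1.symm⟩
          | rw [← h.2, neg_neg]
        · rw [Prod.mk.injEq] at h
          first
          | exact Or.inl ⟨h.1, h2.symm⟩
          | rw [← h.2, neg_neg]
        · exfalso
          have := congrArg Prod.fst h
          simp only at this
          omega
    · have hstep : pipe D L s = (k, σ) := by
        rcases Entry.eq_zero_or_eq_plus (D c) with h0 | h0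
        · rwa [pipeStep_of_zero h0] at h
        · have hck : ¬ c.On k := fun hk => hc ⟨hk, h0⟩
          unfold Box.On at hck
          unfold pipeStep at h
          rw [h0, if_neg (by simp [Entry.isZero])] at h
          split_ifs at h
          · have := congrArg Prod.fst h
            simp only at this
            omega
          · have := congrArg Prod.fst h
            simp only at this
            omega
          · exact h
      have hs' : s.2 ≠ σ ∨ ∃ b ∈ L, b.On k ∧ D b = Entry.plus := by
        refine hs.imp_right ?_
        rintro ⟨b, hb, hbk⟩
        rw [List.mem_append, List.mem_singleton] at hb
        rcases hb with hb | rfl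
        · exact ⟨b, hb, hbk⟩
        · exact absurd hbk hc
      obtain ⟨L₁, L₂, b, k', rfl, h1, h2, h3, h4⟩ := ih hstep hs'
      refine ⟨L₁, L₂ ++ [c], b, k', by simp, h1, h2, fun z hz hzk => ?_, h4⟩
      rw [List.mem_append, List.mem_singleton] at hz
      rcases hz with hz | rfl
      · exact h3 z hz hzk
      · exact Entry.ne_plus_iff.1 fun h0 => hc ⟨hzk, h0⟩

lemma pipe_lt {D : Filling n} {L : List (Box n)} {s : ℕ × ℤ} (hs : s.1 < n) :
    (pipe D L s).1 < n := by
  induction L generalizing s with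
  | nil => exact hs
  | cons b L ih =>
    rw [pipe_cons]
    apply ih
    have h1 := b.lo_lt_hi
    have h2 := b.hi_lt
    unfold pipeStep
    split_ifs
    exacts [hs, h2, h1.trans h2, hs]

/-- One stretch of a pipe on the hook `k`, from a box `w` to the next box `b` of the hook that
contains a `+`, where it turns into the hook `k'`.  The lists `T` and `T'` are what is left to read
before the box `y`, after `w` and after `b`. -/
lemma IsLowerReading.pipe_next {D : Filling n} {A T : List (Box n)} {w y : Box n}
    (he : IsLowerReading (A ++ w :: T ++ [y])) {b : Box n} {k k' : ℕ} (hw : w.On k)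
    (hb : (b.lo = k ∧ b.hi = k') ∨ (b.hi = k ∧ b.lo = k')) (hwb : w < b) (hby : b < y)
    (hD : D b = Entry.plus) (hz : ∀ z, z.On k → w < z → z < b → D z = Entry.zero) (σ : ℤ) :
    ∃ A' T', IsLowerReading (A' ++ b :: T' ++ [y]) ∧ pipe D T (k, σ) = pipe D T' (k', -σ) := by
  have hbk : b.On k := hb.imp And.left And.left
  obtain ⟨T₁, T₂, rfl⟩ := List.append_of_mem (he.mem_between hwb hby)
  refine ⟨A ++ w :: T₁, T₂, by simpa using he, ?_⟩
  have hstraight : pipe D T₁ (k, σ) = (k, σ) := by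
    refine pipe_straight fun z hzT hzk => hz z hzk ?_ ?_
    · exact lt_of_pairwise (l₁ := A ++ [w]) (l₂ := T₁ ++ b :: T₂ ++ [y])
        (by simpa using he.pairwise) (by simp) (by simp [hzT]) hw hzk
    · exact lt_of_pairwise (l₁ := A ++ w :: T₁) (l₂ := b :: T₂ ++ [y])
        (by simpa using he.pairwise) (by simp [hzT]) (by simp) hzk hbk
  rw [pipe_append, pipe_cons, hstraight, pipeStep_turn hD hb]

/-- The last stretch of a pipe, from a box `w` to the box `y` on the hook `k`. -/
lemma IsLowerReading.pipe_end {D : Filling n} {A T : List (Box n)} {w y : Box n}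
    (he : IsLowerReading (A ++ w :: T ++ [y])) {k : ℕ} (hw : w.On k) (hy : y.On k)
    (hz : ∀ z, z.On k → w < z → z < y → D z = Entry.zero) (σ : ℤ) :
    pipe D T (k, σ) = (k, σ) := by
  refine pipe_straight fun z hzT hzk => hz z hzk ?_ ?_
  · exact lt_of_pairwise (l₁ := A ++ [w]) (l₂ := T ++ [y]) (by simpa using he.pairwise)
      (by simp) (by simp [hzT]) hw hzk
  · exact lt_of_pairwise (l₁ := A ++ w :: T) (l₂ := [y]) (by simpa using he.pairwise)
      (by simp [hzT]) (by simp) hzk hy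

/-- The two pipes that leave the box `x` for the boxes `L` arrive on the two hooks of `y`, both with
negative sign. -/
def PipesMeet (D : Filling n) (L : List (Box n)) (x y : Box n) : Prop :=
  (pipe D L (x.lo, 1) = (y.lo, -1) ∧ pipe D L (x.hi, 1) = (y.hi, -1)) ∨
    (pipe D L (x.lo, 1) = (y.hi, -1) ∧ pipe D L (x.hi, 1) = (y.lo, -1))

variable {W : Type*} [Group W] (hn : 3 ≤ n) (cs : CoxeterSystem (typeD n) W)

/-- The product of a diagram moves coordinate vectors along pipes. -/
lemma IsLowerReading.rep_pipe {D : Filling n} {P L : List (Box n)} (he : IsLowerReading (P ++ L))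
    {s : ℕ × ℤ} (hs : s.1 < n) :
    rep hn cs (diagramProd cs L D)
        (rep hn cs (diagramProd cs P (zeroFilling n)) (s.2 • basisVec n s.1)) =
      rep hn cs (diagramProd cs (P ++ L) (zeroFilling n))
        ((pipe D L s).2 • basisVec n (pipe D L s).1) := by
  induction L generalizing P s with
  | nil => simp [pipe]
  | cons b L ih =>
    have he' : IsLowerReading (P ++ [b] ++ L) := by simpa using he
    have hlt : (pipeStep D s b).1 < n := pipe_lt (L := [b]) hs
    have h := ih he' hlt
    rw [List.append_assoc, List.singleton_append] at h
    rw [pipe_cons, ← h, diagramProd_cons, rep_mul_apply]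
    congr 1
    rw [diagramProd_append, diagramProd_singleton, boxFactor_zero (D := zeroFilling n) cs rfl,
      rep_mul_apply]
    rcases Entry.eq_zero_or_eq_plus (D b) with h0 | h0
    · rw [pipeStep_of_zero h0, boxFactor_zero cs h0]
    · rw [boxFactor_plus cs h0, map_one, Module.End.one_apply, rep_simple_apply,
        ← he'.of_append.rep_boxRoot hn cs, rep_dotProduct_rep, ← map_smul, ← map_sub]
      congr 1
      have h1 := b.lo_lt_hi
      have h2 := b.hi_lt
      rw [boxRoot, smul_dotProduct, dotProduct_add]
      rw [basisVec_dotProduct_basisVec hlt, basisVec_dotProduct_basisVec hlt]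
      obtain ⟨k, σ⟩ := s
      by_cases hlo : b.lo = k
      · subst hlo
        rw [pipeStep_turn h0 (Or.inl ⟨rfl, rfl⟩), if_neg (by simp only; omega), if_pos rfl]
        module
      by_cases hhi : b.hi = k
      · subst hhi
        rw [pipeStep_turn h0 (Or.inr ⟨rfl, rfl⟩), if_pos rfl, if_neg (by simp only; omega)]
        module
      rw [pipeStep_of_not_on (by simpa [Box.On] using ⟨hlo, hhi⟩), if_neg (by simp only; omega),
        if_neg (by simp only; omega)]
      module

/-- The product of a diagram between two boxes `x` and `y` takes the simple root of `x` to that of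
`y` if and only if the two pipes that leave `x` meet again at `y`, both with negative sign. -/
lemma IsLowerReading.rep_eq_simpleRoot_iff {D : Filling n} {e₁ L : List (Box n)} {x y : Box n}
    (he : IsLowerReading (e₁ ++ x :: L ++ [y])) :
    rep hn cs (diagramProd cs L D) (simpleRoot n x.label) = simpleRoot n y.label ↔
      PipesMeet D L x y := by
  have he' : IsLowerReading (e₁ ++ [x] ++ L ++ [y]) := by simpa using he
  have hx := he'.of_append.of_append.rep_boxRoot hn cs
  have hy := he'.rep_boxRoot hn cs
  have hx' : rep hn cs (diagramProd cs (e₁ ++ [x]) (zeroFilling n)) (boxRoot x) =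
      -simpleRoot n x.label := by
    rw [diagramProd_append, diagramProd_singleton, boxFactor_zero cs rfl, rep_mul_apply, hx,
      rep_simple_simpleRoot]
  have hxlo : x.lo < n := x.lo_lt_hi.trans x.hi_lt
  have h1 := he'.of_append.rep_pipe hn cs (D := D) (s := (x.lo, 1)) hxlo
  have h2 := he'.of_append.rep_pipe hn cs (D := D) (s := (x.hi, 1)) x.hi_lt
  have h3 : rep hn cs (diagramProd cs L D) (simpleRoot n x.label) =
      rep hn cs (diagramProd cs (e₁ ++ [x] ++ L) (zeroFilling n))
        (-((pipe D L (x.lo, 1)).2 • basisVec n (pipe D L (x.lo, 1)).1 +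
          (pipe D L (x.hi, 1)).2 • basisVec n (pipe D L (x.hi, 1)).1)) := by
    rw [map_neg, map_add, ← h1, ← h2, ← map_add, ← map_add, one_smul, one_smul,
      ← neg_eq_iff_eq_neg, ← map_neg, ← hx', boxRoot]
  have hk1 : (pipe D L (x.lo, 1)).1 < n := pipe_lt hxlo
  have hk2 : (pipe D L (x.hi, 1)).1 < n := pipe_lt x.hi_lt
  rw [h3, ← hy, (rep_injective hn cs _).eq_iff, PipesMeet]
  generalize pipe D L (x.lo, 1) = s₁ at hk1 ⊢
  generalize pipe D L (x.hi, 1) = s₂ at hk2 ⊢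
  obtain ⟨k₁, σ₁⟩ := s₁
  obtain ⟨k₂, σ₂⟩ := s₂
  simp only [Prod.mk.injEq] at hk1 hk2 ⊢
  have hylt := y.lo_lt_hi
  constructor
  · intro h
    have e1 := congrArg (fun v => v ⬝ᵥ basisVec n y.lo) h
    have e2 := congrArg (fun v => v ⬝ᵥ basisVec n y.hi) h
    simp only [boxRoot, neg_dotProduct, add_dotProduct, smul_dotProduct,
      basisVec_dotProduct_basisVec hk1, basisVec_dotProduct_basisVec hk2,
      basisVec_dotProduct_basisVec (hylt.trans y.hi_lt), basisVec_dotProduct_basisVec y.hi_lt,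
      smul_eq_mul, mul_ite, mul_one, mul_zero] at e1 e2
    split_ifs at e1 e2 <;> omega
  · rintro (⟨⟨rfl, rfl⟩, rfl, rfl⟩ | ⟨⟨rfl, rfl⟩, rfl, rfl⟩) <;> rw [boxRoot] <;> module

end Pipes

/-! ### The three conditions in terms of hooks -/

section Conditions

variable {n : ℕ}

/-- The box in which the hooks `i < j` meet exists and contains a `+`. -/
def PlusAt (D : Filling n) (i j : ℕ) : Prop := ∃ b : Box n, b.lo = i ∧ b.hi = j ∧ D b = Entry.plus

lemma PlusAt.of_box {D : Filling n} {b : Box n} (h : D b = Entry.plus) : PlusAt D b.lo b.hi :=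
  ⟨b, rfl, rfl, h⟩

lemma PlusAt.eq_plus {D : Filling n} {b : Box n} (h : PlusAt D b.lo b.hi) : D b = Entry.plus := by
  obtain ⟨c, h1, h2, h3⟩ := h
  rwa [← Box.ext_hooks h1 h2]

lemma plusAt_iff {D : Filling n} {b : Box n} : PlusAt D b.lo b.hi ↔ D b = Entry.plus :=
  ⟨PlusAt.eq_plus, PlusAt.of_box⟩

lemma not_plusAt_iff {D : Filling n} {b : Box n} : ¬ PlusAt D b.lo b.hi ↔ D b = Entry.zero := by
  rw [plusAt_iff]
  exact Entry.ne_plus_iff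

/-- The conditions that a `0` at the intersection of the hooks `i < j` imposes on a Le-diagram. -/
structure ZeroConditions (D : Filling n) (i j : ℕ) : Prop where
  not_plus_below : ∀ i' j', i' < i → i < j' → j' < j → PlusAt D i' j → ¬ PlusAt D i j'
  not_plus_row : ∀ i' a, a < i' → i' < i → PlusAt D i' j → ¬ PlusAt D a i
  not_plus_three : ∀ b k q, b < k → k < i → i < q → q < j → PlusAt D k j → PlusAt D k i →
    ¬ PlusAt D b q

lemma leConditions_iff {O : Set (Box n)} (hO : IsLowerSet O) (D : Filling n) :
    LeConditions O D ↔ ∀ c ∈ O, D c = Entry.zero → ZeroConditions D c.lo c.hi := by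
  have hdist : ∀ c : Box n, c.dist = c.hi - 1 - c.lo := fun c => rfl
  have hcol : ∀ c : Box n, c.col = c.lo := fun c => rfl
  have hrow : ∀ c : Box n, c.row = c.hi - 1 := fun c => rfl
  have hlt := fun c : Box n => c.lo_lt_hi
  constructor
  · intro h c hc h0
    have hmem : ∀ b : Box n, b.lo ≤ c.lo → b.hi ≤ c.hi → b ∈ O := fun b h1 h2 =>
      hO (Box.le_iff.2 ⟨h1, h2⟩) hc
    have hcl := hlt c
    refine ⟨?_, ?_, ?_⟩
    · rintro i' j' hi' hj' hj'' ⟨b, hb1, hb2, hb⟩ ⟨a, ha1, ha2, ha⟩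
      have := h.cond₁ c hc a (hmem a (by omega) (by omega)) h0 ha (by rw [hcol, hcol, ha1])
        (by have := hlt a; rw [hrow, hrow]; omega) b (hmem b (by omega) (by omega))
        (by rw [hrow, hrow, hb2]) (by rw [hcol, hcol]; omega)
      rw [hb] at this
      cases this
    · rintro i' a' ha' hi' ⟨b, hb1, hb2, hb⟩ ⟨a, ha1, ha2, ha⟩
      have := hlt a
      have := hlt b
      exact h.cond₂ c hc b (hmem b (by omega) (by omega)) h0 hb (by rw [hrow, hrow, hb2])
        (by rw [hcol, hcol]; omega) ⟨a, hmem a (by omega) (by omega), ha,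
          by rw [hrow, hrow]; omega, by rw [hcol, hcol]; omega, by rw [hrow, hrow, hdist]; omega⟩
    · rintro b' k q hbk hki hiq hqj ⟨b₁, h11, h12, h1⟩ ⟨b₂, h21, h22, h2⟩ ⟨b₃, h31, h32, h3⟩
      have := hlt b₁
      have := hlt b₂
      have := hlt b₃
      exact h.cond₃ ⟨c, hc, b₁, hmem _ (by omega) (by omega), b₂, hmem _ (by omega) (by omega), b₃,
        hmem _ (by omega) (by omega), h0, h1, h2, h3,
        ⟨by rw [hrow, hrow]; omega, by rw [hcol, hcol]; omega⟩,
        ⟨by rw [hcol, hcol]; omega, by rw [hrow, hrow, hdist]; omega⟩,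
        ⟨by rw [hrow, hrow]; omega, by rw [hcol, hcol]; omega⟩, by rw [hrow, hrow]; omega⟩
  · intro h
    refine ⟨?_, ?_, ?_⟩
    · intro c hc a _ h0 ha h1 h2 b _ h3 h4
      rw [hcol, hcol] at h1 h4
      rw [hrow, hrow] at h2 h3
      have h5 := hlt a
      have h6 := hlt b
      have h7 := hlt c
      by_contra hb
      have hb' : D b = Entry.plus := (Entry.eq_zero_or_eq_plus _).resolve_left hb
      exact (h c hc h0).not_plus_below b.lo a.hi h4 (by omega) (by omega)
        ⟨b, rfl, by omega, hb'⟩ ⟨a, h1, rfl, ha⟩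
    · rintro c hc b _ h0 hb h1 h2 ⟨a, _, ha, h3, h4, h5⟩
      rw [hcol, hcol] at h2 h4
      rw [hrow, hrow] at h1 h3 h5
      rw [hdist] at h5
      have := hlt a
      have := hlt b
      have := hlt c
      exact (h c hc h0).not_plus_row b.lo a.lo h4 h2 ⟨b, rfl, by omega, hb⟩ ⟨a, rfl, by omega, ha⟩
    · rintro ⟨c, hc, b₁, _, b₂, _, b₃, _, h0, h1, h2, h3, ⟨h4, h5⟩, ⟨h6, h7⟩, ⟨h8, h9⟩, h10⟩
      rw [hcol, hcol] at h5 h6 h9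
      rw [hrow, hrow] at h4 h7 h8 h10
      rw [hdist] at h7
      have := hlt b₁
      have := hlt b₂
      have := hlt b₃
      have := hlt c
      exact (h c hc h0).not_plus_three b₃.lo b₁.lo b₃.hi (by omega) h5 (by omega) (by omega)
        ⟨b₁, rfl, by omega, h1⟩ ⟨b₂, h6, by omega, h2⟩ ⟨b₃, rfl, rfl, h3⟩

end Conditions

/-! ### The three conditions imply positive distinguishedness -/

section Ascent

variable {n : ℕ}

/-- The last turn of a pipe before a box `y` on its hook `k`, for a pipe that turns at all. -/
lemma IsLowerReading.last_turn {D : Filling n} {A L : List (Box n)} {y : Box n}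
    (he : IsLowerReading (A ++ L ++ [y])) {s : ℕ × ℤ} {k : ℕ} {σ : ℤ} (hy : y.On k)
    (h : pipe D L s = (k, σ)) (hs : s.2 ≠ σ ∨ ∃ b ∈ L, b.On k ∧ D b = Entry.plus) :
    ∃ (L₁ L₂ : List (Box n)) (b : Box n) (k' : ℕ), L = L₁ ++ b :: L₂ ∧ D b = Entry.plus ∧
      ((b.lo = k ∧ b.hi = k') ∨ (b.hi = k ∧ b.lo = k')) ∧ b < y ∧
      (∀ z, z.On k → b < z → z < y → D z = Entry.zero) ∧ pipe D L₁ s = (k', -σ) := by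
  obtain ⟨L₁, L₂, b, k', rfl, h1, h2, h3, h4⟩ := exists_last_turn h hs
  refine ⟨L₁, L₂, b, k', rfl, h1, h2, ?_, fun z hzk hbz hzy => ?_, h4⟩
  · exact lt_of_pairwise (l₁ := A ++ (L₁ ++ b :: L₂)) he.pairwise (by simp) (by simp)
      (h2.imp And.left And.left) hy
  · refine h3 z ?_ hzk
    exact IsLowerReading.mem_between (e₁ := A ++ L₁) (by simpa using he) hbz hzy

/-- In a diagram that satisfies the three conditions, two pipes that start with positive sign do
not meet with negative signs at a `0`.  The two pipes would last turn, on the hooks `j` and `i` of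
the box, at boxes that the conditions force onto the same hook; going one or two more turns back
along the pipe that arrives on `j`, one finds a `+` that they forbid. -/
lemma IsLowerReading.not_meet {D : Filling n} {A L : List (Box n)} {y : Box n}
    (he : IsLowerReading (A ++ L ++ [y])) (h0 : D y = Entry.zero)
    (hD : ∀ c ≤ y, D c = Entry.zero → ZeroConditions D c.lo c.hi) {h₁ h₂ : ℕ}
    (hp₁ : pipe D L (h₁, 1) = (y.hi, -1)) (hp₂ : pipe D L (h₂, 1) = (y.lo, -1)) : False := by
  have hylt := y.lo_lt_hi
  have hyn := y.hi_lt
  have hcond := hD y le_rfl h0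
  obtain ⟨L₁, L₂, b, i', rfl, hb, hbon, hby, hbz, hq⟩ :=
    he.last_turn (Or.inr rfl) hp₁ (Or.inl (by norm_num))
  rw [Box.lt_iff] at hby
  have hblt := b.lo_lt_hi
  obtain ⟨hbhi, hblo⟩ : b.hi = y.hi ∧ b.lo = i' := by omega
  obtain ⟨M₁, M₂, b', l, hM, hb', hbon', hby', hbz', -⟩ :=
    he.last_turn (Or.inl rfl) hp₂ (Or.inl (by norm_num))
  rw [Box.lt_iff] at hby'
  have hblt' := b'.lo_lt_hi
  have hPb : PlusAt D i' y.hi := ⟨b, hblo, hbhi, hb⟩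
  have hi' : i' < y.lo := by omega
  rcases hbon' with ⟨hlo', hhi'⟩ | ⟨hhi', hlo'⟩
  · exact hcond.not_plus_below i' b'.hi hi' (by omega) (by omega) hPb ⟨b', hlo', rfl, hb'⟩
  have hPb' : PlusAt D l y.lo := ⟨b', hlo', hhi', hb'⟩
  have hl : l = i' := by
    rcases lt_trichotomy l i' with h | h | h
    · exact absurd hPb' (hcond.not_plus_row i' l h hi' hPb)
    · exact h
    · exfalso
      have hz : D (Box.ofHooks l y.hi (by omega) hyn) = Entry.zero := by
        refine hbz _ (Or.inr (by simp)) (Box.lt_iff.2 ?_) (Box.lt_iff.2 ?_) <;>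
          simp only [Box.lo_ofHooks, Box.hi_ofHooks] <;> omega
      have hc := hD _ (Box.le_iff.2 (by simp only [Box.lo_ofHooks, Box.hi_ofHooks]; omega)) hz
      simp only [Box.lo_ofHooks, Box.hi_ofHooks] at hc
      exact hc.not_plus_below i' y.lo h (by omega) hylt hPb hPb'
  subst hl
  -- the first pipe, on the hook `l` before `b`, passes or turns at the box `b'` of that hook
  have hb'b : b' < b := Box.lt_iff.2 (by omega)
  have hp := he.pairwise
  have hb'mem : b' ∈ L₁ := by
    have hmem : b' ∈ L₁ ++ b :: L₂ := by rw [hM]; simp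
    rw [List.mem_append, List.mem_cons] at hmem
    rcases hmem with h | rfl | h
    · exact h
    · exact absurd hb'b (lt_irrefl _)
    · have h1 : b < b' := by
        refine lt_of_pairwise (l₁ := A ++ L₁ ++ [b]) (l₂ := L₂ ++ [y]) (k := l) (by simpa using hp)
          (by simp) (by simp [h]) (Or.inl hblo) (Or.inl hlo')
      exact absurd h1 hb'b.asymm
  have he₁ : IsLowerReading (A ++ L₁ ++ [b]) :=
    IsLowerReading.of_append (e₂ := L₂ ++ [y]) (by simpa using he)
  obtain ⟨N₁, N₂, c, m, rfl, hc, hcon, hcb, hcz, hr⟩ :=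
    he₁.last_turn (Or.inl hblo) hq (Or.inr ⟨b', hb'mem, Or.inl hlo', hb'⟩)
  have hb'c : b' ≤ c := by
    by_contra hne
    have hcl : c.On l := hcon.imp And.left And.left
    have hlt : c < b' :=
      lt_of_le_not_ge ((hcl.le_or_le (Or.inl hlo')).resolve_right hne) hne
    have := hcz b' (Or.inl hlo') hlt hb'b
    rw [hb'] at this
    cases this
  rw [Box.lt_iff] at hcb
  rw [Box.le_iff] at hb'c
  have hclt := c.lo_lt_hi
  obtain ⟨hclo, hchi⟩ : c.lo = l ∧ c.hi = m := by omega
  have he₂ : IsLowerReading (A ++ N₁ ++ [c]) :=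
    IsLowerReading.of_append (e₂ := N₂ ++ [b]) (by simpa using he₁)
  obtain ⟨-, -, d, a, -, hd, hdon, hdc, -, -⟩ :=
    he₂.last_turn (Or.inr hchi) hr (Or.inl (by norm_num))
  rw [Box.lt_iff] at hdc
  have hdlt := d.lo_lt_hi
  obtain ⟨hdhi, hdlo⟩ : d.hi = m ∧ d.lo = a := by omega
  have hPd : PlusAt D a m := ⟨d, hdlo, hdhi, hd⟩
  rcases (show m = y.lo ∨ y.lo < m by omega) with h | h
  · exact hcond.not_plus_row l a (by omega) hi' hPb (h ▸ hPd)
  · exact hcond.not_plus_three a l m (by omega) hi' h (by omega) hPb hPb' hPd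

variable {W : Type*} [Group W] (hn : 3 ≤ n) (cs : CoxeterSystem (typeD n) W)

include hn in
/-- No letter of `𝐯(D)` is a descent: along the reading order, the image of the simple root of `x`
stays positive, as it can only become negative at a `0` whose simple root it equals. -/
lemma LeConditions.length_lt {O : Set (Box n)} (hO : IsLowerSet O) {D : Filling n}
    (hD : LeConditions O D) {e₁ e₂ : List (Box n)} {x : Box n}
    (he : IsReadingOrder O (e₁ ++ x :: e₂)) :
    cs.length (diagramProd cs e₂ D) < cs.length (diagramProd cs e₂ D * cs.simple x.label) := by
  rw [leConditions_iff hO] at hD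
  apply length_lt_of_height_pos hn
  suffices h : ∀ L R, e₂ = L ++ R →
      0 < rep hn cs (diagramProd cs L D) (simpleRoot n x.label) ⬝ᵥ heightVec n from
    h e₂ [] (by simp)
  intro L
  induction L using List.reverseRecOn with
  | nil =>
    intro R _
    rw [diagramProd_nil, map_one, Module.End.one_apply, simpleRoot_dotProduct_heightVec (by omega)]
    norm_num
  | append_singleton L y ih =>
    rintro R rfl
    have hpos := ih (y :: R) (by simp)
    have hlow : IsLowerReading (e₁ ++ x :: L ++ [y]) :=
      he.isLowerReading hO (e₂ := R) (by simp)
    have hyO : y ∈ O := (he.mem_iff y).1 (by simp)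
    rw [diagramProd_append, diagramProd_singleton]
    rcases Entry.eq_zero_or_eq_plus (D y) with h0 | h0
    · rw [boxFactor_zero cs h0]
      by_contra hneg
      have hroot := rep_eq_simpleRoot_of_height hn cs hpos hneg
      rw [hlow.rep_eq_simpleRoot_iff hn cs] at hroot
      have hlow' : IsLowerReading (e₁ ++ [x] ++ L ++ [y]) := by simpa using hlow
      have hD' : ∀ c ≤ y, D c = Entry.zero → ZeroConditions D c.lo c.hi := fun c hc =>
        hD c (hO hc hyO)
      rcases hroot with ⟨h1, h2⟩ | ⟨h1, h2⟩
      · exact hlow'.not_meet h0 hD' h2 h1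
      · exact hlow'.not_meet h0 hD' h1 h2
    · rwa [boxFactor_plus cs h0, one_mul]

lemma bruhatLT_mul_simple {w : W} {i : Fin n}
    (h : cs.length w < cs.length (w * cs.simple i)) : BruhatLT cs w (w * cs.simple i) :=
  Relation.TransGen.single ⟨_, cs.isReflection_simple i, rfl, h⟩

lemma BruhatLT.length_lt {u v : W} (h : BruhatLT cs u v) : cs.length u < cs.length v := by
  induction h with
  | single h => obtain ⟨t, -, -, h⟩ := h; exact h
  | tail _ h ih => obtain ⟨t, -, -, h⟩ := h; exact ih.trans h

include hn in
lemma isReduced_reading {O : Set (Box n)} (hO : IsLowerSet O) {e : List (Box n)}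
    (he : IsReadingOrder O e) : cs.IsReduced (e.reverse.map Box.label) := by
  have hD : LeConditions O (zeroFilling n) := by
    rw [leConditions_iff hO]
    have hno : ∀ i j, ¬ PlusAt (zeroFilling n) i j := by
      rintro i j ⟨b, -, -, hb⟩
      cases hb
    exact fun c _ _ => ⟨fun _ _ _ _ _ h => absurd h (hno _ _), fun _ _ _ _ h => absurd h (hno _ _),
      fun _ _ _ _ _ _ _ h => absurd h (hno _ _)⟩
  have hprod : cs.wordProd (e.reverse.map Box.label) = diagramProd cs e (zeroFilling n) := by
    simp [diagramProd, subexpr, subexprProd, CoxeterSystem.wordProd, zeroFilling, Entry.isZero,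
      Function.comp_def]
  have hlen : ∀ e₂ e₁, e = e₁ ++ e₂ →
      cs.length (diagramProd cs e₂ (zeroFilling n)) = e₂.length := by
    intro e₂
    induction e₂ with
    | nil => intro e₁ _; simp
    | cons b e₂ ih =>
      intro e₁ h
      have h1 := ih (e₁ ++ [b]) (by simp [h])
      have h2 := hD.length_lt hn cs hO (h ▸ he)
      rw [diagramProd_cons, boxFactor_zero cs rfl, List.length_cons]
      have h3 := cs.length_mul_simple (diagramProd cs e₂ (zeroFilling n)) b.label
      omega
  unfold CoxeterSystem.IsReduced
  rw [hprod, hlen e [] (by simp)]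
  simp

include hn in
lemma LeConditions.isPDS {O : Set (Box n)} (hO : IsLowerSet O) {D : Filling n}
    (hD : LeConditions O D) {e : List (Box n)} (he : IsReadingOrder O e) :
    IsPDS cs (subexpr e D) where
  reduced := by
    have : (subexpr e D).map Prod.fst = e.reverse.map Box.label := by
      simp [subexpr]
    rw [this]
    exact isReduced_reading hn cs hO he
  lt_mul_simple k hk := by
    have hk' : k < e.reverse.length := by simpa [subexpr] using hk
    have hsplit : e = (e.reverse.drop (k + 1)).reverse ++
        e.reverse[k] :: (e.reverse.take k).reverse := by
      rw [← List.reverse_inj]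
      simp only [List.reverse_append, List.reverse_cons, List.reverse_reverse, List.append_assoc,
        List.singleton_append]
      rw [List.cons_getElem_drop_succ, List.take_append_drop]
    have hget : ((subexpr e D)[k]).1 = (e.reverse[k]).label := by
      simp [subexpr]
    have htake : subexprProd cs ((subexpr e D).take k) =
        diagramProd cs (e.reverse.take k).reverse D := by
      rw [diagramProd, subexpr, subexpr, List.reverse_reverse, List.map_take]
    rw [hget, htake]
    exact bruhatLT_mul_simple cs (hD.length_lt hn cs hO (hsplit ▸ he))

/-- A positive distinguished subexpression is determined by its product: read from the right, the
letter `s` is present if and only if it is a right descent of what remains. -/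
lemma IsPDS.eq_of_prod_eq {e : List (Box n)} {D E : Filling n} (hD : IsPDS cs (subexpr e D))
    (hE : IsPDS cs (subexpr e E)) (h : diagramProd cs e D = diagramProd cs e E) :
    ∀ b ∈ e, D b = E b := by
  have key : ∀ {F : Filling n}, IsPDS cs (subexpr e F) → ∀ e₁ e₂ x, e = e₁ ++ x :: e₂ →
      cs.length (diagramProd cs e₂ F) < cs.length (diagramProd cs e₂ F * cs.simple x.label) := by
    rintro F hF e₁ e₂ x rfl
    have hk : e₂.length < (subexpr (e₁ ++ x :: e₂) F).length := by
      simp [subexpr]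
    have hs : subexpr (e₁ ++ x :: e₂) F =
        subexpr e₂ F ++ (x.label, (F x).isZero) :: subexpr e₁ F := by
      simp [subexpr]
    have hl : (subexpr e₂ F).length = e₂.length := by simp [subexpr]
    have h := (hF.lt_mul_simple e₂.length hk).length_lt
    simp only [hs, ← hl] at h
    simpa [diagramProd] using h
  suffices hmain : ∀ e₂ e₁, e = e₁ ++ e₂ → diagramProd cs e₂ D = diagramProd cs e₂ E →
      ∀ b ∈ e₂, D b = E b from hmain e [] rfl h
  intro e₂
  induction e₂ with
  | nil => simp
  | cons x e₂ ih =>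
    intro e₁ he hx
    have h1 := key hD e₁ e₂ x he
    have h2 := key hE e₁ e₂ x he
    rw [diagramProd_cons, diagramProd_cons] at hx
    rcases Entry.eq_zero_or_eq_plus (D x) with hDx | hDx <;>
      rcases Entry.eq_zero_or_eq_plus (E x) with hEx | hEx
    · rw [boxFactor_zero cs hDx, boxFactor_zero cs hEx, mul_left_inj] at hx
      simpa [hDx, hEx] using ih (e₁ ++ [x]) (by simp [he]) hx
    · rw [boxFactor_zero cs hDx, boxFactor_plus cs hEx, mul_one] at hx
      rw [← hx, cs.simple_mul_simple_cancel_right] at h2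
      omega
    · rw [boxFactor_plus cs hDx, boxFactor_zero cs hEx, mul_one] at hx
      rw [hx, cs.simple_mul_simple_cancel_right] at h1
      omega
    · rw [boxFactor_plus cs hDx, boxFactor_plus cs hEx, mul_left_inj] at hx
      simpa [hDx, hEx] using ih (e₁ ++ [x]) (by simp [he]) hx

end Ascent

/-! ### The fillings of the moves in terms of hooks -/

section Fillings

variable {n : ℕ} {D : Filling n} {x y : Box n}

lemma Entry.none_or_some {a b : Entry} : (some a = none ∨ some a = some b) ↔ b = a := by
  simp [eq_comm]

lemma compatible_filling₀ (h1 : x.lo < y.lo) (h2 : x.hi < y.hi) (h3 : y.lo < x.hi) :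
    Compatible (Set.Ioo x y) D (filling₀ x y) ↔
      PlusAt D x.lo y.hi ∧ PlusAt D y.lo x.hi ∧
      ∀ z, x < z → z < y → D z = Entry.plus →
        (z.lo = x.lo ∧ z.hi = y.hi) ∨ (z.lo = y.lo ∧ z.hi = x.hi) := by
  have hval : ∀ z : Box n, filling₀ x y z =
      if (z.hi = y.hi ∧ z.lo = x.lo) ∨ (z.hi = x.hi ∧ z.lo = y.lo) then some Entry.plus
      else some Entry.zero := fun z => by
    unfold filling₀ Box.hi
    simp only [Nat.add_right_cancel_iff]
    rfl
  have hyn := y.hi_lt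
  constructor
  · intro h
    have hplus : ∀ i j : ℕ, x.lo ≤ i → x.hi ≤ j → i ≤ y.lo → j ≤ y.hi →
        ((j = y.hi ∧ i = x.lo) ∨ (j = x.hi ∧ i = y.lo)) → PlusAt D i j := by
      intro i j hi hj hi' hj' hor
      refine ⟨Box.ofHooks i j (by omega) (by omega), by simp, by simp, ?_⟩
      have hz := h (Box.ofHooks i j (by omega) (by omega)) ⟨by
        rw [Box.lt_iff, Box.lo_ofHooks, Box.hi_ofHooks]; omega, by
        rw [Box.lt_iff, Box.lo_ofHooks, Box.hi_ofHooks]; omega⟩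
      rw [hval, Box.lo_ofHooks, Box.hi_ofHooks, if_pos hor, Entry.none_or_some] at hz
      exact hz
    refine ⟨hplus _ _ (by omega) (by omega) (by omega) (by omega) (by omega),
      hplus _ _ (by omega) (by omega) (by omega) (by omega) (by omega), fun z hxz hzy hz => ?_⟩
    by_contra hne
    have := h z ⟨hxz, hzy⟩
    rw [hval, if_neg (by omega), Entry.none_or_some, hz] at this
    cases this
  · rintro ⟨hp1, hp2, hall⟩ z ⟨hxz, hzy⟩
    rw [hval]
    split_ifs with h
    · refine Or.inr (congrArg some (Eq.symm ?_))
      rcases h with ⟨h4, h5⟩ | ⟨h4, h5⟩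
      · exact PlusAt.eq_plus (h4 ▸ h5 ▸ hp1)
      · exact PlusAt.eq_plus (h4 ▸ h5 ▸ hp2)
    · refine Or.inr (congrArg some (Eq.symm ?_))
      refine Entry.ne_plus_iff.1 fun hz => ?_
      have := hall z hxz hzy hz
      omega

lemma compatible_filling₁ {k : ℕ} (hk : 0 < k) (hy : y.lo = x.hi + k) :
    Compatible (Set.Ioo x y) D (filling₁ x y k) ↔
      PlusAt D x.hi y.hi ∧ PlusAt D x.lo y.lo ∧
      ∀ z, x < z → z < y → D z = Entry.plus →
        (z.lo = x.hi ∧ z.hi = y.hi) ∨ (z.lo = x.lo ∧ z.hi = y.lo) ∨ (z.lo = x.hi ∧ z.hi = y.lo) ∨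
        (z.lo < x.hi ∧ y.lo < z.hi) := by
  have hval : ∀ z : Box n, filling₁ x y k z =
      if z.hi = y.hi ∧ z.lo = x.hi then some Entry.plus
      else if z.lo = x.lo ∧ z.hi = y.lo then some Entry.plus
      else if z.lo = x.hi ∧ z.hi = y.lo then none
      else if z.lo < x.hi ∧ y.lo < z.hi then none
      else some Entry.zero := fun z => by
    have e1 : z.row = y.row ↔ z.hi = y.hi := by unfold Box.hi; omega
    have e2 : z.col + k = y.col ↔ z.lo = x.hi := by
      change z.lo + k = y.lo ↔ _; omega
    have e3 : z.row = x.row + k ↔ z.hi = y.lo := by rw [hy]; unfold Box.hi; omega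
    have e4 : z.col + k < y.col ↔ z.lo < x.hi := by
      change z.lo + k < y.lo ↔ _; omega
    have e5 : x.row + k < z.row ↔ y.lo < z.hi := by rw [hy]; unfold Box.hi; omega
    unfold filling₁
    simp only [e1, e2, e3, e4, e5]
    rfl
  have hyn := y.hi_lt
  have hxlt := x.lo_lt_hi
  have hylt := y.lo_lt_hi
  constructor
  · intro h
    have hplus : ∀ i j : ℕ, i < j → x.lo ≤ i → x.hi ≤ j → i ≤ y.lo → j ≤ y.hi →
        ((j = y.hi ∧ i = x.hi) ∨ (i = x.lo ∧ j = y.lo)) → PlusAt D i j := by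
      intro i j hij hi hj hi' hj' hor
      refine ⟨Box.ofHooks i j hij (by omega), by simp, by simp, ?_⟩
      have hz := h (Box.ofHooks i j (by omega) (by omega)) ⟨by
        rw [Box.lt_iff, Box.lo_ofHooks, Box.hi_ofHooks]; omega, by
        rw [Box.lt_iff, Box.lo_ofHooks, Box.hi_ofHooks]; omega⟩
      rw [hval, Box.lo_ofHooks, Box.hi_ofHooks] at hz
      split_ifs at hz
      · exact (Option.some.inj (hz.resolve_left id)).symm
      · exact (Option.some.inj (hz.resolve_left id)).symm
      · omega
      · omega
      · omega
    refine ⟨hplus _ _ (by omega) (by omega) (by omega) (by omega) (by omega) (by omega),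
      hplus _ _ (by omega) (by omega) (by omega) (by omega) (by omega) (by omega),
      fun z hxz hzy hz => ?_⟩
    by_contra hne
    have := h z ⟨hxz, hzy⟩
    rw [hval, if_neg (by omega), if_neg (by omega), if_neg (by omega), if_neg (by omega),
      Entry.none_or_some, hz] at this
    cases this
  · rintro ⟨hp1, hp2, hall⟩ z ⟨hxz, hzy⟩
    rw [hval]
    split_ifs with h4 h5 h6 h7
    · refine Or.inr (congrArg some (Eq.symm ?_))
      exact PlusAt.eq_plus (h4.1 ▸ h4.2 ▸ hp1)
    · refine Or.inr (congrArg some (Eq.symm ?_))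
      exact PlusAt.eq_plus (h5.1 ▸ h5.2 ▸ hp2)
    · exact Or.inl rfl
    · exact Or.inl rfl
    · refine Or.inr (congrArg some (Eq.symm ?_))
      refine Entry.ne_plus_iff.1 fun hz => ?_
      have := hall z hxz hzy hz
      omega

lemma compatible_filling₂ {k ρ : ℕ} (hk : 0 < k) (hy : y.lo = x.hi + k) (hρ : y.lo < ρ + 1)
    (hρ' : ρ + 1 < y.hi) :
    Compatible (Set.Ioo x y) D (filling₂ x y k ρ) ↔
      PlusAt D x.hi y.hi ∧ PlusAt D x.hi y.lo ∧ PlusAt D x.hi (ρ + 1) ∧ PlusAt D x.lo (ρ + 1) ∧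
      ∀ z, x < z → z < y → D z = Entry.plus →
        (z.lo = x.hi ∧ (z.hi = y.hi ∨ z.hi = y.lo ∨ z.hi = ρ + 1)) ∨
        (z.lo = x.lo ∧ z.hi = ρ + 1) ∨ (z.lo < x.hi ∧ ρ + 1 < z.hi) ∨
        (z.lo = x.hi ∧ y.lo < z.hi ∧ z.hi < ρ + 1) := by
  have hval : ∀ z : Box n, filling₂ x y k ρ z =
      if z.lo = x.hi ∧ (z.hi = y.hi ∨ z.hi = ρ + 1 ∨ z.hi = y.lo) then some Entry.plus
      else if z.lo = x.lo ∧ z.hi = ρ + 1 then some Entry.plus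
      else if z.lo < x.hi ∧ ρ + 1 < z.hi then none
      else if z.lo = x.hi ∧ y.lo < z.hi ∧ z.hi < ρ + 1 then none
      else some Entry.zero := fun z => by
    have e1 : z.row = y.row ↔ z.hi = y.hi := by unfold Box.hi; omega
    have e2 : z.col + k = y.col ↔ z.lo = x.hi := by
      change z.lo + k = y.lo ↔ _; omega
    have e3 : z.row = x.row + k ↔ z.hi = y.lo := by rw [hy]; unfold Box.hi; omega
    have e4 : z.col + k < y.col ↔ z.lo < x.hi := by
      change z.lo + k < y.lo ↔ _; omega
    have e5 : x.row + k < z.row ↔ y.lo < z.hi := by rw [hy]; unfold Box.hi; omega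
    have e6 : z.row = ρ ↔ z.hi = ρ + 1 := by unfold Box.hi; omega
    have e7 : ρ < z.row ↔ ρ + 1 < z.hi := by unfold Box.hi; omega
    have e8 : z.row < ρ ↔ z.hi < ρ + 1 := by unfold Box.hi; omega
    unfold filling₂
    simp only [e1, e2, e3, e4, e5, e6, e7, e8]
    rfl
  have hyn := y.hi_lt
  have hxlt := x.lo_lt_hi
  have hylt := y.lo_lt_hi
  constructor
  · intro h
    have hplus : ∀ i j : ℕ, i < j → x.lo ≤ i → x.hi ≤ j → i ≤ y.lo → j ≤ y.hi →
        ((i = x.hi ∧ (j = y.hi ∨ j = ρ + 1 ∨ j = y.lo)) ∨ (i = x.lo ∧ j = ρ + 1)) →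
          PlusAt D i j := by
      intro i j hij hi hj hi' hj' hor
      refine ⟨Box.ofHooks i j hij (by omega), by simp, by simp, ?_⟩
      have hz := h (Box.ofHooks i j (by omega) (by omega)) ⟨by
        rw [Box.lt_iff, Box.lo_ofHooks, Box.hi_ofHooks]; omega, by
        rw [Box.lt_iff, Box.lo_ofHooks, Box.hi_ofHooks]; omega⟩
      rw [hval, Box.lo_ofHooks, Box.hi_ofHooks] at hz
      split_ifs at hz
      · exact (Option.some.inj (hz.resolve_left id)).symm
      · exact (Option.some.inj (hz.resolve_left id)).symm
      · omega
      · omega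
      · omega
    refine ⟨hplus _ _ (by omega) (by omega) (by omega) (by omega) (by omega) (by omega),
      hplus _ _ (by omega) (by omega) (by omega) (by omega) (by omega) (by omega),
      hplus _ _ (by omega) (by omega) (by omega) (by omega) (by omega) (by omega),
      hplus _ _ (by omega) (by omega) (by omega) (by omega) (by omega) (by omega),
      fun z hxz hzy hz => ?_⟩
    by_contra hne
    have := h z ⟨hxz, hzy⟩
    rw [hval, if_neg (by omega), if_neg (by omega), if_neg (by omega), if_neg (by omega),
      Entry.none_or_some, hz] at this
    cases this
  · rintro ⟨hp1, hp2, hp3, hp4, hall⟩ z ⟨hxz, hzy⟩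
    rw [hval]
    split_ifs with h4 h5 h6 h7
    · refine Or.inr (congrArg some (Eq.symm ?_))
      rcases h4 with ⟨h4, h5 | h5 | h5⟩
      · exact PlusAt.eq_plus (h4 ▸ h5 ▸ hp1)
      · exact PlusAt.eq_plus (h4 ▸ h5 ▸ hp3)
      · exact PlusAt.eq_plus (h4 ▸ h5 ▸ hp2)
    · refine Or.inr (congrArg some (Eq.symm ?_))
      exact PlusAt.eq_plus (h5.1 ▸ h5.2 ▸ hp4)
    · exact Or.inl rfl
    · exact Or.inl rfl
    · refine Or.inr (congrArg some (Eq.symm ?_))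
      refine Entry.ne_plus_iff.1 fun hz => ?_
      have := hall z hxz hzy hz
      omega

lemma row_eq_iff {k : ℕ} : y.row = x.row + (k + (y.dist + 1)) ↔ y.lo = x.hi + k := by
  have h1 := y.lo_lt_hi
  unfold Box.lo Box.hi at *
  unfold Box.dist
  omega

end Fillings

/-! ### The triples are Le-moves -/

section Moves

variable {n : ℕ} {D : Filling n} {x y : Box n} {A L : List (Box n)}

lemma pipesMeet_filling₀ (he : IsLowerReading (A ++ x :: L ++ [y])) (h1 : x.lo < y.lo)
    (h2 : x.hi < y.hi) (h3 : y.lo < x.hi) (hD : Compatible (Set.Ioo x y) D (filling₀ x y)) :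
    PipesMeet D L x y := by
  obtain ⟨⟨b, hb1, hb2, hb⟩, ⟨c, hc1, hc2, hc⟩, hall⟩ := (compatible_filling₀ h1 h2 h3).1 hD
  have hzero : ∀ z, x < z → z < y →
      ¬ ((z.lo = x.lo ∧ z.hi = y.hi) ∨ (z.lo = y.lo ∧ z.hi = x.hi)) → D z = Entry.zero :=
    fun z h4 h5 h6 => Entry.ne_plus_iff.1 fun h => h6 (hall z h4 h5 h)
  simp only [Box.lt_iff] at hzero
  right
  constructor
  · obtain ⟨A', T, he', hT⟩ := he.pipe_next (k := x.lo) (k' := y.hi) (Or.inl rfl)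
      (Or.inl ⟨hb1, hb2⟩) (by rw [Box.lt_iff]; omega) (by rw [Box.lt_iff]; omega) hb
      (fun z hz h4 h5 => by
        unfold Box.On at hz; rw [Box.lt_iff] at h4 h5
        exact hzero z (by omega) (by omega) (by omega)) 1
    rw [hT]
    exact he'.pipe_end (Or.inr hb2) (Or.inr rfl) (fun z hz h4 h5 => by
      unfold Box.On at hz; rw [Box.lt_iff] at h4 h5
      exact hzero z (by omega) (by omega) (by omega)) _
  · obtain ⟨A', T, he', hT⟩ := he.pipe_next (k := x.hi) (k' := y.lo) (Or.inr rfl)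
      (Or.inr ⟨hc2, hc1⟩) (by rw [Box.lt_iff]; omega) (by rw [Box.lt_iff]; omega) hc
      (fun z hz h4 h5 => by
        unfold Box.On at hz; rw [Box.lt_iff] at h4 h5
        exact hzero z (by omega) (by omega) (by omega)) 1
    rw [hT]
    exact he'.pipe_end (Or.inl hc1) (Or.inl rfl) (fun z hz h4 h5 => by
      unfold Box.On at hz; rw [Box.lt_iff] at h4 h5
      exact hzero z (by omega) (by omega) (by omega)) _

/-- The two pipes leave `x` along the hooks `x.lo` and `x.hi`, and turn into the hooks `y.lo` and
`x.hi`; these meet in the box whose entry is arbitrary, and whether or not the pipes turn there,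
one of them goes on along `y.lo` and the other one along `x.hi`, from which it turns into `y.hi`. -/
lemma pipesMeet_filling₁ (he : IsLowerReading (A ++ x :: L ++ [y])) {k : ℕ} (hk : 0 < k)
    (hy : y.lo = x.hi + k) (hD : Compatible (Set.Ioo x y) D (filling₁ x y k)) :
    PipesMeet D L x y := by
  obtain ⟨⟨b, hb1, hb2, hb⟩, ⟨c, hc1, hc2, hc⟩, hall⟩ := (compatible_filling₁ hk hy).1 hD
  have hyn := y.hi_lt
  have hxlt := x.lo_lt_hi
  have hylt := y.lo_lt_hi
  have hzero : ∀ z, x < z → z < y →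
      ¬ ((z.lo = x.hi ∧ z.hi = y.hi) ∨ (z.lo = x.lo ∧ z.hi = y.lo) ∨
        (z.lo = x.hi ∧ z.hi = y.lo) ∨ (z.lo < x.hi ∧ y.lo < z.hi)) → D z = Entry.zero :=
    fun z h4 h5 h6 => Entry.ne_plus_iff.1 fun h => h6 (hall z h4 h5 h)
  simp only [Box.lt_iff] at hzero
  obtain ⟨A₁, T₁, he₁, hT₁⟩ := he.pipe_next (k := x.lo) (k' := y.lo) (Or.inl rfl)
    (Or.inl ⟨hc1, hc2⟩) (by rw [Box.lt_iff]; omega) (by rw [Box.lt_iff]; omega) hc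
    (fun z hz h4 h5 => by
      unfold Box.On at hz; rw [Box.lt_iff] at h4 h5
      have := z.lo_lt_hi
      exact hzero z (by omega) (by omega) (by omega)) 1
  by_cases hcorner : PlusAt D x.hi y.lo
  · obtain ⟨d, hd1, hd2, hd⟩ := hcorner
    right
    constructor
    · obtain ⟨A₂, T₂, he₂, hT₂⟩ := he₁.pipe_next (k := y.lo) (k' := x.hi) (Or.inr hc2)
        (Or.inr ⟨hd2, hd1⟩) (by rw [Box.lt_iff]; omega) (by rw [Box.lt_iff]; omega) hd
        (fun z hz h4 h5 => by
          unfold Box.On at hz; rw [Box.lt_iff] at h4 h5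
          have := z.lo_lt_hi
          exact hzero z (by omega) (by omega) (by omega)) (-1)
      obtain ⟨A₃, T₃, he₃, hT₃⟩ := he₂.pipe_next (k := x.hi) (k' := y.hi) (Or.inl hd1)
        (Or.inl ⟨hb1, hb2⟩) (by rw [Box.lt_iff]; omega) (by rw [Box.lt_iff]; omega) hb
        (fun z hz h4 h5 => by
          unfold Box.On at hz; rw [Box.lt_iff] at h4 h5
          have := z.lo_lt_hi
          exact hzero z (by omega) (by omega) (by omega)) (- -1)
      rw [hT₁, hT₂, hT₃]
      exact he₃.pipe_end (Or.inr hb2) (Or.inr rfl) (fun z hz h4 h5 => by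
        unfold Box.On at hz; rw [Box.lt_iff] at h4 h5
        have := z.lo_lt_hi
        exact hzero z (by omega) (by omega) (by omega)) _
    · obtain ⟨A₂, T₂, he₂, hT₂⟩ := he.pipe_next (k := x.hi) (k' := y.lo) (Or.inr rfl)
        (Or.inl ⟨hd1, hd2⟩) (by rw [Box.lt_iff]; omega) (by rw [Box.lt_iff]; omega) hd
        (fun z hz h4 h5 => by
          unfold Box.On at hz; rw [Box.lt_iff] at h4 h5
          have := z.lo_lt_hi
          exact hzero z (by omega) (by omega) (by omega)) 1
      rw [hT₂]
      exact he₂.pipe_end (Or.inr hd2) (Or.inl rfl) (fun z hz h4 h5 => by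
        unfold Box.On at hz; rw [Box.lt_iff] at h4 h5
        have := z.lo_lt_hi
        exact hzero z (by omega) (by omega) (by omega)) _
  · have hcorner' : ∀ z : Box n, z.lo = x.hi → z.hi = y.lo → D z = Entry.zero := fun z h4 h5 =>
      Entry.ne_plus_iff.1 fun h => hcorner ⟨z, h4, h5, h⟩
    left
    constructor
    · rw [hT₁]
      exact he₁.pipe_end (Or.inr hc2) (Or.inl rfl) (fun z hz h4 h5 => by
        unfold Box.On at hz; rw [Box.lt_iff] at h4 h5
        have := z.lo_lt_hi
        by_cases h : z.lo = x.hi ∧ z.hi = y.lo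
        · exact hcorner' z h.1 h.2
        · exact hzero z (by omega) (by omega) (by omega)) _
    · obtain ⟨A₂, T₂, he₂, hT₂⟩ := he.pipe_next (k := x.hi) (k' := y.hi) (Or.inr rfl)
        (Or.inl ⟨hb1, hb2⟩) (by rw [Box.lt_iff]; omega) (by rw [Box.lt_iff]; omega) hb
        (fun z hz h4 h5 => by
          unfold Box.On at hz; rw [Box.lt_iff] at h4 h5
          have := z.lo_lt_hi
          by_cases h : z.lo = x.hi ∧ z.hi = y.lo
          · exact hcorner' z h.1 h.2
          · exact hzero z (by omega) (by omega) (by omega)) 1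
      rw [hT₂]
      exact he₂.pipe_end (Or.inr hb2) (Or.inr rfl) (fun z hz h4 h5 => by
        unfold Box.On at hz; rw [Box.lt_iff] at h4 h5
        have := z.lo_lt_hi
        exact hzero z (by omega) (by omega) (by omega)) _

/-- The pipe on `x.hi` turns into `y.lo` and stays there; the pipe on `x.lo` turns into the hook
of the row `ρ`, then into `x.hi`, above the boxes whose entries are arbitrary, and then into
`y.hi`. -/
lemma pipesMeet_filling₂ (he : IsLowerReading (A ++ x :: L ++ [y])) {k ρ : ℕ} (hk : 0 < k)
    (hy : y.lo = x.hi + k) (hρ : y.lo < ρ + 1) (hρ' : ρ + 1 < y.hi)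
    (hD : Compatible (Set.Ioo x y) D (filling₂ x y k ρ)) :
    PipesMeet D L x y := by
  obtain ⟨⟨b, hb1, hb2, hb⟩, ⟨c, hc1, hc2, hc⟩, ⟨d, hd1, hd2, hd⟩, ⟨a, ha1, ha2, ha⟩, hall⟩ :=
    (compatible_filling₂ hk hy hρ hρ').1 hD
  have hyn := y.hi_lt
  have hxlt := x.lo_lt_hi
  have hylt := y.lo_lt_hi
  have hzero : ∀ z, x < z → z < y →
      ¬ ((z.lo = x.hi ∧ (z.hi = y.hi ∨ z.hi = y.lo ∨ z.hi = ρ + 1)) ∨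
        (z.lo = x.lo ∧ z.hi = ρ + 1) ∨ (z.lo < x.hi ∧ ρ + 1 < z.hi) ∨
        (z.lo = x.hi ∧ y.lo < z.hi ∧ z.hi < ρ + 1)) → D z = Entry.zero :=
    fun z h4 h5 h6 => Entry.ne_plus_iff.1 fun h => h6 (hall z h4 h5 h)
  simp only [Box.lt_iff] at hzero
  right
  constructor
  · obtain ⟨A₁, T₁, he₁, hT₁⟩ := he.pipe_next (k := x.lo) (k' := ρ + 1) (Or.inl rfl)
      (Or.inl ⟨ha1, ha2⟩) (by rw [Box.lt_iff]; omega) (by rw [Box.lt_iff]; omega) ha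
      (fun z hz h4 h5 => by
        unfold Box.On at hz; rw [Box.lt_iff] at h4 h5
        have := z.lo_lt_hi
        exact hzero z (by omega) (by omega) (by omega)) 1
    obtain ⟨A₂, T₂, he₂, hT₂⟩ := he₁.pipe_next (k := ρ + 1) (k' := x.hi) (Or.inr ha2)
      (Or.inr ⟨hd2, hd1⟩) (by rw [Box.lt_iff]; omega) (by rw [Box.lt_iff]; omega) hd
      (fun z hz h4 h5 => by
        unfold Box.On at hz; rw [Box.lt_iff] at h4 h5
        have := z.lo_lt_hi
        exact hzero z (by omega) (by omega) (by omega)) (-1)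
    obtain ⟨A₃, T₃, he₃, hT₃⟩ := he₂.pipe_next (k := x.hi) (k' := y.hi) (Or.inl hd1)
      (Or.inl ⟨hb1, hb2⟩) (by rw [Box.lt_iff]; omega) (by rw [Box.lt_iff]; omega) hb
      (fun z hz h4 h5 => by
        unfold Box.On at hz; rw [Box.lt_iff] at h4 h5
        have := z.lo_lt_hi
        exact hzero z (by omega) (by omega) (by omega)) (- -1)
    rw [hT₁, hT₂, hT₃]
    exact he₃.pipe_end (Or.inr hb2) (Or.inr rfl) (fun z hz h4 h5 => by
      unfold Box.On at hz; rw [Box.lt_iff] at h4 h5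
      have := z.lo_lt_hi
      exact hzero z (by omega) (by omega) (by omega)) _
  · obtain ⟨A₁, T₁, he₁, hT₁⟩ := he.pipe_next (k := x.hi) (k' := y.lo) (Or.inr rfl)
      (Or.inl ⟨hc1, hc2⟩) (by rw [Box.lt_iff]; omega) (by rw [Box.lt_iff]; omega) hc
      (fun z hz h4 h5 => by
        unfold Box.On at hz; rw [Box.lt_iff] at h4 h5
        have := z.lo_lt_hi
        exact hzero z (by omega) (by omega) (by omega)) 1
    rw [hT₁]
    exact he₁.pipe_end (Or.inr hc2) (Or.inl rfl) (fun z hz h4 h5 => by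
      unfold Box.On at hz; rw [Box.lt_iff] at h4 h5
      have := z.lo_lt_hi
      exact hzero z (by omega) (by omega) (by omega)) _

/-- The union of the three families. -/
abbrev allMoves (n : ℕ) : Set (Triple n) := moves₀ n ∪ moves₁ n ∪ moves₂ n

lemma lt_of_mem_allMoves {m : Triple n} (hm : m ∈ allMoves n) : m.x < m.y := by
  rcases hm with (⟨h1, h2, -, -⟩ | h) | h
  · rw [Box.lt_iff]
    unfold Box.lo Box.hi
    omega
  · exact h.1
  · exact h.1

lemma pipesMeet_of_mem_allMoves {m : Triple n} (hm : m ∈ allMoves n)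
    (hD : Compatible (Set.Ioo m.x m.y) D m.S) (he : IsLowerReading (A ++ m.x :: L ++ [m.y])) :
    PipesMeet D L m.x m.y := by
  rcases hm with (⟨h1, h2, h3, h4⟩ | ⟨-, k, hk, hy, h4⟩) | ⟨-, k, ρ, hk, hy, h1, h2, h4⟩
  · rw [h4] at hD
    refine pipesMeet_filling₀ he h2 (Nat.succ_lt_succ h1) (Nat.lt_succ_of_le h3) hD
  · rw [h4] at hD
    exact pipesMeet_filling₁ he hk (row_eq_iff.1 hy) hD
  · rw [h4] at hD
    have hy' := row_eq_iff.1 hy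
    refine pipesMeet_filling₂ he hk hy' ?_ (Nat.succ_lt_succ h2) hD
    rw [hy']
    unfold Box.hi
    omega

variable {W : Type*} [Group W] (hn : 3 ≤ n) (cs : CoxeterSystem (typeD n) W)

include hn in
lemma diagramProd_mul_simple_of_mem_allMoves {m : Triple n} (hm : m ∈ allMoves n)
    (hD : Compatible (Set.Ioo m.x m.y) D m.S) (he : IsLowerReading (A ++ m.x :: L ++ [m.y])) :
    diagramProd cs L D * cs.simple m.x.label = cs.simple m.y.label * diagramProd cs L D :=
  mul_simple_eq_of_rep_eq hn cs
    ((he.rep_eq_simpleRoot_iff hn cs).2 (pipesMeet_of_mem_allMoves hm hD he))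

lemma mem_rowReading {C : Set (Box n)} {b : Box n} : b ∈ rowReading C ↔ b ∈ C :=
  (isReadingOrder_rowReading C).mem_iff b

/-- A list of the boxes of `C` that is sorted by rows, and by columns in each row, is the row
reading order. -/
lemma rowReading_eq {C : Set (Box n)} {l : List (Box n)}
    (hl : l.Pairwise fun a b => a.1.1 < b.1.1 ∨ (a.1.1 = b.1.1 ∧ a.1.2 < b.1.2))
    (hmem : ∀ b, b ∈ l ↔ b ∈ C) : rowReading C = l := by
  have hirr : ∀ {l : List (Box n)},
      (l.Pairwise fun a b => a.1.1 < b.1.1 ∨ (a.1.1 = b.1.1 ∧ a.1.2 < b.1.2)) → l.Nodup := by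
    intro l hl
    refine hl.imp ?_
    rintro a b h rfl
    rcases h with h | h
    · exact lt_irrefl _ h
    · exact lt_irrefl _ h.2
  refine List.Perm.eq_of_pairwise ?_ ((pairwise_rowOrder n).filter _) hl ?_
  · intro a b _ _ h1 h2
    omega
  · rw [List.perm_ext_iff_of_nodup (isReadingOrder_rowReading C).nodup (hirr hl)]
    intro b
    rw [mem_rowReading, hmem]

lemma rowSorted_of_lt {a b : Box n} (h : a < b) :
    a.1.1 < b.1.1 ∨ (a.1.1 = b.1.1 ∧ a.1.2 < b.1.2) := by
  have h1 : a.1.1 ≤ b.1.1 ∧ a.1.2 ≤ b.1.2 := h.le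
  rcases h1.1.lt_or_eq with h2 | h2
  · exact Or.inl h2
  · refine Or.inr ⟨h2, lt_of_le_of_ne h1.2 fun h3 => h.ne ?_⟩
    exact Subtype.ext (Prod.ext h2 h3)

lemma rowReading_Ico (hxy : x < y) :
    rowReading (Set.Ico x y) = x :: rowReading (Set.Ioo x y) := by
  refine rowReading_eq (List.pairwise_cons.2 ⟨fun b hb => ?_, (pairwise_rowOrder n).filter _⟩)
    fun b => ?_
  · exact rowSorted_of_lt (mem_rowReading.1 hb).1
  · rw [List.mem_cons, mem_rowReading, ← Set.Ioo_insert_left hxy, Set.mem_insert_iff]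

lemma rowReading_Ioc (hxy : x < y) :
    rowReading (Set.Ioc x y) = rowReading (Set.Ioo x y) ++ [y] := by
  refine rowReading_eq (List.pairwise_append.2 ⟨(pairwise_rowOrder n).filter _,
    List.pairwise_singleton _ _, fun a ha b hb => ?_⟩) fun b => ?_
  · rw [List.mem_singleton] at hb
    subst hb
    exact rowSorted_of_lt (mem_rowReading.1 ha).2
  · rw [List.mem_append, List.mem_singleton, mem_rowReading, ← Set.Ioo_insert_right hxy,
      Set.mem_insert_iff, or_comm]

/-- The boxes `≤ y` can be read with those that are not `≥ x` first; the boxes between `x` and `y`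
are then read consecutively. -/
lemma isLowerReading_interval (hxy : x < y) :
    IsLowerReading (rowReading (Set.Iic y \ Set.Ici x) ++ x :: rowReading (Set.Ioo x y) ++ [y]) := by
  have h : IsReadingOrder (Set.Iic y)
      (rowReading (Set.Iic y \ Set.Ici x) ++ x :: rowReading (Set.Ioo x y) ++ [y]) := by
    have h1 := isReadingOrder_rowReading (Set.Iic y \ Set.Ici x)
    have h2 := isReadingOrder_rowReading (Set.Ioo x y)
    have hmem : ∀ b, b ∈ rowReading (Set.Iic y \ Set.Ici x) ++ x :: rowReading (Set.Ioo x y) ++ [y]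
        ↔ b ∈ Set.Iic y := by
      intro b
      simp only [List.mem_append, List.mem_cons, mem_rowReading, List.not_mem_nil, or_false,
        Set.mem_sdiff, Set.mem_Iic, Set.mem_Ici, Set.mem_Ioo]
      constructor
      · rintro ((h | rfl | h) | rfl)
        · exact h.1
        · exact hxy.le
        · exact h.2.le
        · exact le_rfl
      · intro h
        rcases h.lt_or_eq with h3 | h3
        · by_cases h4 : x ≤ b
          · rcases h4.lt_or_eq with h5 | h5
            · exact Or.inl (Or.inr (Or.inr ⟨h5, h3⟩))
            · exact Or.inl (Or.inr (Or.inl h5.symm))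
          · exact Or.inl (Or.inl ⟨h, h4⟩)
        · exact Or.inr h3
    refine ⟨?_, hmem, ?_⟩
    · rw [List.nodup_append, List.nodup_append, List.nodup_cons]
      refine ⟨⟨h1.nodup, ⟨?_, h2.nodup⟩, ?_⟩, by simp, ?_⟩
      · simp [mem_rowReading]
      · rintro a ha b hb rfl
        rw [mem_rowReading] at ha
        rw [List.mem_cons, mem_rowReading] at hb
        rcases hb with rfl | hb
        · exact ha.2 (Set.mem_Ici.2 le_rfl)
        · exact ha.2 hb.1.le
      · rintro a ha b hb rfl
        rw [List.mem_singleton] at hb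
        subst hb
        rw [List.mem_append, List.mem_cons, mem_rowReading, mem_rowReading] at ha
        rcases ha with ha | rfl | ha
        · exact ha.2 hxy.le
        · exact lt_irrefl _ hxy
        · exact lt_irrefl _ ha.2
    · rw [List.pairwise_append, List.pairwise_append, List.pairwise_cons]
      refine ⟨⟨h1.linear, ⟨?_, h2.linear⟩, ?_⟩, by simp, ?_⟩
      · intro a ha hlt
        rw [mem_rowReading] at ha
        exact hlt.asymm ha.1
      · intro a ha b hb hlt
        rw [mem_rowReading] at ha
        rw [List.mem_cons, mem_rowReading] at hb
        rcases hb with rfl | hb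
        · exact ha.2 hlt.le
        · exact ha.2 (hb.1.trans hlt).le
      · intro a ha b hb hlt
        rw [List.mem_singleton] at hb
        subst hb
        have := (hmem a).1 (List.mem_append_left _ ha)
        exact absurd hlt (not_lt_of_ge this)
  exact h.isLowerReading (isLowerSet_Iic y) (e₂ := []) (by simp)

include hn in
lemma isLeMove_of_mem_allMoves {m : Triple n} (hm : m ∈ allMoves n) : IsLeMove cs m := by
  have hxy := lt_of_mem_allMoves hm
  refine ⟨hxy, fun D hD => ?_⟩
  change diagramProd cs (rowReading _) _ = diagramProd cs (rowReading _) _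
  rw [rowReading_Ico hxy, rowReading_Ioc hxy, diagramProd_cons, diagramProd_append,
    diagramProd_singleton, boxFactor_zero cs (by simp), boxFactor_zero cs (by simp)]
  rw [diagramProd_congr cs (D := Function.update D m.x Entry.zero) (D' := D),
    diagramProd_congr cs (D := Function.update D m.y Entry.zero) (D' := D)]
  · exact diagramProd_mul_simple_of_mem_allMoves hn cs hm hD (isLowerReading_interval hxy)
  · intro b hb
    rw [mem_rowReading] at hb
    exact Function.update_of_ne hb.2.ne _ _
  · intro b hb
    rw [mem_rowReading] at hb
    exact Function.update_of_ne hb.1.ne' _ _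

include hn in
/-- A move does not change the product of a diagram, for any reading order. -/
lemma Performs.diagramProd_eq {O : Set (Box n)} (hO : IsLowerSet O) {e : List (Box n)}
    (he : IsReadingOrder O e) {m : Triple n} (hm : m ∈ allMoves n) {D' : Filling n}
    (h : Performs O m D D') : diagramProd cs e D' = diagramProd cs e D := by
  obtain ⟨hsub, hy, hcomp, rfl⟩ := h
  have hxy := lt_of_mem_allMoves hm
  have hxe : m.x ∈ e := (he.mem_iff _).2 (hsub ⟨le_rfl, hxy.le⟩)
  have hye : m.y ∈ e := (he.mem_iff _).2 (hsub ⟨hxy.le, le_rfl⟩)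
  obtain ⟨e₁, e₂, rfl⟩ := List.append_of_mem hxe
  have hnd := he.nodup
  have hy2 : m.y ∈ e₂ := by
    rw [List.mem_append, List.mem_cons] at hye
    rcases hye with h | h | h
    · exact absurd hxy ((List.pairwise_append.1 he.linear).2.2 _ h _ (by simp))
    · exact absurd h hxy.ne'
    · exact h
  obtain ⟨L, e₃, rfl⟩ := List.append_of_mem hy2
  have hlow : IsLowerReading (e₁ ++ m.x :: L ++ [m.y]) :=
    he.isLowerReading hO (e₂ := e₃) (by simp)
  have hkey := diagramProd_mul_simple_of_mem_allMoves hn cs hm hcomp hlow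
  have hne : ∀ l : List (Box n), m.x ∉ l → m.y ∉ l →
      diagramProd cs l (Function.update (Function.update D m.y Entry.plus) m.x (D m.x).switch) =
        diagramProd cs l D := by
    intro l hx hy
    refine diagramProd_congr cs fun b hb => ?_
    rw [Function.update_of_ne (by rintro rfl; exact hx hb),
      Function.update_of_ne (by rintro rfl; exact hy hb)]
  simp only [List.nodup_append, List.nodup_cons, List.mem_append, List.mem_cons, not_or] at hnd
  obtain ⟨-, ⟨⟨hx1, -, hx2⟩, -, ⟨hy3, -⟩, hL⟩, h1⟩ := hnd
  have hx0 : m.x ∉ e₁ := fun h => h1 _ h _ (Or.inl rfl) rfl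
  have hy0 : m.y ∉ e₁ := fun h => h1 _ h _ (Or.inr (Or.inr (Or.inl rfl))) rfl
  have hyL : m.y ∉ L := fun h => hL _ h _ (Or.inl rfl) rfl
  simp only [diagramProd_append, diagramProd_cons]
  rw [hne e₁ hx0 hy0, hne L hx1 hyL, hne e₃ hx2 hy3, boxFactor_zero cs hy,
    boxFactor_plus cs (b := m.y) (by rw [Function.update_of_ne hxy.ne', Function.update_self])]
  rcases Entry.eq_zero_or_eq_plus (D m.x) with h0 | h0
  · rw [boxFactor_zero cs h0, boxFactor_plus cs (b := m.x) (by simp [h0, Entry.switch]), mul_one,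
      mul_one, mul_assoc (diagramProd cs e₃ D) (cs.simple m.y.label), ← hkey]
    simp [mul_assoc]
  · rw [boxFactor_plus cs h0, boxFactor_zero cs (b := m.x) (by simp [h0, Entry.switch]), mul_one,
      mul_one, mul_assoc (diagramProd cs e₃ D) (cs.simple m.y.label), ← hkey]
    simp only [mul_assoc]

end Moves

/-! ### Completeness -/

section Completeness

variable {n : ℕ}

lemma exists_greatest_lt {P : ℕ → Prop} {N : ℕ} (h : ∃ k < N, P k) :
    ∃ k < N, P k ∧ ∀ m, k < m → m < N → ¬ P m := by
  obtain ⟨k, hk, hP⟩ := h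
  have hfin : {m | m < N ∧ P m}.Finite := (Set.finite_lt_nat N).subset fun m hm => hm.1
  obtain ⟨m, hm, hmax⟩ := hfin.exists_maximal ⟨k, hk, hP⟩
  refine ⟨m, hm.1, hm.2, fun l hl hlN hPl => ?_⟩
  have := hmax (y := l) ⟨hlN, hPl⟩ hl.le
  omega

lemma exists_performs {O : Set (Box n)} (hO : IsLowerSet O) {m : Triple n} {D : Filling n}
    (hm : m ∈ allMoves n) (hy : m.y ∈ O) (h0 : D m.y = Entry.zero)
    (hD : Compatible (Set.Ioo m.x m.y) D m.S) :
    ∃ m ∈ allMoves n, ∃ D', Performs O m D D' :=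
  ⟨m, hm, _, fun _ hb => hO hb.2 hy, h0, hD, rfl⟩

/-- If the three conditions fail, a move of one of the three families can be performed.  The box
`y` of the move is a minimal `0` at which a condition fails; the `+`s of the move are chosen as
close to `y` as possible, and any other `+` where the filling demands a `0` would make a condition
fail at a smaller `0`. -/
lemma exists_move {O : Set (Box n)} (hO : IsLowerSet O) {D : Filling n}
    (hD : ¬ LeConditions O D) : ∃ m ∈ allMoves n, ∃ D', Performs O m D D' := by
  rw [leConditions_iff hO] at hD
  have hne : {c | c ∈ O ∧ D c = Entry.zero ∧ ¬ ZeroConditions D c.lo c.hi}.Nonempty := by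
    by_contra hempty
    refine hD fun c hc h0 => ?_
    by_contra h
    exact hempty ⟨c, hc, h0, h⟩
  obtain ⟨y, ⟨hyO, hy0, hbad⟩, hmin⟩ := wellFounded_lt.has_min _ hne
  have hyn := y.hi_lt
  have hylt := y.lo_lt_hi
  have hgood : ∀ i j, i < j → i ≤ y.lo → j ≤ y.hi → (i < y.lo ∨ j < y.hi) → ¬ PlusAt D i j →
      ZeroConditions D i j := by
    intro i j hij hi hj hlt hP
    by_contra h
    have hlt' : Box.ofHooks i j hij (by omega) < y := by
      rw [Box.lt_iff, Box.lo_ofHooks, Box.hi_ofHooks]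
      exact ⟨hi, hj, hlt⟩
    refine hmin (Box.ofHooks i j hij (by omega)) ⟨hO hlt'.le hyO, ?_, ?_⟩ hlt'
    · rw [← not_plusAt_iff, Box.lo_ofHooks, Box.hi_ofHooks]
      exact hP
    · rwa [Box.lo_ofHooks, Box.hi_ofHooks]
  have hrow : ∃ i' < y.lo, PlusAt D i' y.hi := by
    by_contra h
    push Not at h
    exact hbad ⟨fun i' _ hi' _ _ hP => absurd hP (h i' hi'),
      fun i' _ _ hi' hP => absurd hP (h i' hi'), fun _ k _ _ hk _ _ hP => absurd hP (h k hk)⟩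
  obtain ⟨i', hi', hPi', hmaxi'⟩ := exists_greatest_lt hrow
  by_cases h1 : ∃ j' < y.hi, y.lo < j' ∧ PlusAt D y.lo j'
  · -- the first condition fails at `y`
    obtain ⟨j', hj', ⟨hij', hPj'⟩, hmaxj'⟩ := exists_greatest_lt h1
    obtain ⟨x, hx1, hx2⟩ : ∃ x : Box n, x.lo = i' ∧ x.hi = j' :=
      ⟨Box.ofHooks i' j' (by omega) (by omega), Box.lo_ofHooks .., Box.hi_ofHooks ..⟩
    refine exists_performs (m := ⟨x, y, filling₀ x y⟩) hO (Or.inl (Or.inl ⟨?_, ?_, ?_, rfl⟩)) hyO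
      hy0 ?_
    · unfold Box.lo Box.hi at *; simp only; omega
    · unfold Box.lo Box.hi at *; simp only; omega
    · unfold Box.lo Box.hi at *; simp only; omega
    change Compatible (Set.Ioo x y) D (filling₀ x y)
    refine (compatible_filling₀ (by omega) (by omega) (by omega)).2 ⟨by rwa [hx1], by rwa [hx2],
      fun z hxz hzy hz => ?_⟩
    rw [Box.lt_iff] at hxz hzy
    have hzlt := z.lo_lt_hi
    have hPz := PlusAt.of_box hz
    generalize z.lo = p at *
    generalize z.hi = m at *
    by_contra hneg
    rcases (by omega : (m = y.hi ∧ i' < p ∧ p < y.lo) ∨ (p = y.lo ∧ j' < m ∧ m < y.hi) ∨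
      (p < y.lo ∧ j' < m ∧ m < y.hi) ∨ (m = j' ∧ i' < p ∧ p < y.lo)) with h | h | h | h
    · exact hmaxi' p (by omega) (by omega) (h.1 ▸ hPz)
    · exact hmaxj' m (by omega) (by omega) ⟨by omega, h.1 ▸ hPz⟩
    · exact (hgood y.lo m (by omega) le_rfl (by omega) (by omega)
        fun hP => hmaxj' m (by omega) (by omega) ⟨by omega, hP⟩).not_plus_below p j' (by omega)
          hij' (by omega) hPz hPj'
    · exact (hgood p y.hi (by omega) (by omega) le_rfl (by omega)
        fun hP => hmaxi' p (by omega) (by omega) hP).not_plus_below i' m (by omega) (by omega)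
          (by omega) hPi' hPz
  have hcol : ∀ m, y.lo < m → m < y.hi → ¬ PlusAt D y.lo m := fun m h2 h3 h4 =>
    h1 ⟨m, h3, h2, h4⟩
  by_cases h2 : ∃ a < i', PlusAt D a y.lo
  · -- the second condition fails at `y`
    obtain ⟨a, ha, hPa, hmaxa⟩ := exists_greatest_lt h2
    obtain ⟨x, hx1, hx2⟩ : ∃ x : Box n, x.lo = a ∧ x.hi = i' :=
      ⟨Box.ofHooks a i' (by omega) (by omega), Box.lo_ofHooks .., Box.hi_ofHooks ..⟩
    have hk : y.lo = x.hi + (y.lo - i') := by omega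
    refine exists_performs (m := ⟨x, y, filling₁ x y (y.lo - i')⟩) hO
      (Or.inl (Or.inr ⟨?_, y.lo - i', by omega, row_eq_iff.2 hk, rfl⟩)) hyO hy0 ?_
    · simp only [Box.lt_iff]; omega
    refine (compatible_filling₁ (by omega) hk).2 ⟨by rwa [hx2], by rwa [hx1],
      fun z hxz hzy hz => ?_⟩
    rw [Box.lt_iff] at hxz hzy
    have hzlt := z.lo_lt_hi
    have hPz := PlusAt.of_box hz
    generalize z.lo = p at *
    generalize z.hi = m at *
    by_contra hneg
    rcases lt_trichotomy p i' with hp | hp | hp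
    · rcases (by omega : (m = y.lo ∧ a < p) ∨ (i' < m ∧ m < y.lo) ∨ (m = i' ∧ a < p)) with
        h | h | h
      · exact hmaxa p (by omega) (by omega) (h.1 ▸ hPz)
      · exact (hgood m y.hi (by omega) (by omega) le_rfl (by omega)
          (hmaxi' m (by omega) (by omega))).not_plus_row i' p (by omega) (by omega) hPi' hPz
      · exact (hgood p y.lo (by omega) (by omega) (by omega) (by omega)
          (hmaxa p (by omega) (by omega))).not_plus_below a m (by omega) (by omega) (by omega)
            hPa hPz
    · subst hp
      rcases (by omega : (y.lo < m ∧ m < y.hi) ∨ m < y.lo) with h | h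
      · exact (hgood y.lo m (by omega) le_rfl (by omega) (by omega)
          (hcol m (by omega) (by omega))).not_plus_row p a ha hi' hPz hPa
      · exact (hgood m y.hi (by omega) (by omega) le_rfl (by omega)
          (hmaxi' m (by omega) (by omega))).not_plus_three a p y.lo ha hzlt h hylt hPi' hPz hPa
    · rcases (by omega : (m = y.hi ∧ p < y.lo) ∨ (p = y.lo ∧ m < y.hi) ∨
        (p < y.lo ∧ y.lo < m ∧ m < y.hi) ∨ (p < y.lo ∧ m ≤ y.lo)) with h | h | h | h
      · exact hmaxi' p (by omega) (by omega) (h.1 ▸ hPz)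
      · exact hcol m (by omega) (by omega) (h.1 ▸ hPz)
      · exact (hgood y.lo m (by omega) le_rfl (by omega) (by omega)
          (hcol m (by omega) (by omega))).not_plus_row p a (by omega) (by omega) hPz hPa
      · exact (hgood p y.hi (by omega) (by omega) le_rfl (by omega)
          (hmaxi' p (by omega) (by omega))).not_plus_below i' m (by omega) (by omega) (by omega)
            hPi' hPz
  have hrow' : ∀ a < i', ¬ PlusAt D a y.lo := fun a h3 h4 => h2 ⟨a, h3, h4⟩
  -- only the third condition fails at `y`
  obtain ⟨hPc, q₀, hq₀⟩ : PlusAt D i' y.lo ∧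
      ∃ q, y.lo < q ∧ q < y.hi ∧ ∃ b < i', PlusAt D b q := by
    by_contra hneg
    refine hbad ⟨fun _ j' _ h3 h4 _ => hcol j' h3 h4, fun k a h3 h4 h5 h6 => ?_,
      fun b k q h3 h4 h5 h6 h7 h8 h9 => ?_⟩
    · have hk : k ≤ i' := by
        by_contra hk
        exact hmaxi' k (by omega) h4 h5
      exact hrow' a (by omega) h6
    · have hk : k = i' := by
        rcases lt_trichotomy k i' with hk | hk | hk
        · exact absurd h8 (hrow' k hk)
        · exact hk
        · exact absurd h7 (hmaxi' k hk h4)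
      subst hk
      exact hneg ⟨h8, q, h5, h6, b, h3, h9⟩
  obtain ⟨q, ⟨hq1, hq2, hq3⟩, hminq⟩ := wellFounded_lt.has_min
    {q | y.lo < q ∧ q < y.hi ∧ ∃ b < i', PlusAt D b q} ⟨q₀, hq₀⟩
  obtain ⟨a, ha, hPa, hmaxa⟩ := exists_greatest_lt hq3
  obtain ⟨ρ, rfl⟩ : ∃ ρ, q = ρ + 1 := ⟨q - 1, by omega⟩
  have hPq : PlusAt D i' (ρ + 1) := by
    by_contra h
    exact (hgood i' (ρ + 1) (by omega) (by omega) (by omega) (by omega) h).not_plus_below a y.lo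
      ha hi' hq1 hPa hPc
  obtain ⟨x, hx1, hx2⟩ : ∃ x : Box n, x.lo = a ∧ x.hi = i' :=
    ⟨Box.ofHooks a i' (by omega) (by omega), Box.lo_ofHooks .., Box.hi_ofHooks ..⟩
  have hk : y.lo = x.hi + (y.lo - i') := by omega
  refine exists_performs (m := ⟨x, y, filling₂ x y (y.lo - i') ρ⟩) hO
    (Or.inr ⟨?_, y.lo - i', ρ, by omega, row_eq_iff.2 hk, ?_, Nat.lt_of_succ_lt_succ hq2, rfl⟩)
    hyO hy0 ?_
  · simp only [Box.lt_iff]; omega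
  · have : x.row + 1 = i' := hx2
    simp only
    omega
  refine (compatible_filling₂ (by omega) hk hq1 hq2).2 ⟨by rwa [hx2], by rwa [hx2], by rwa [hx2],
    by rwa [hx1], fun z hxz hzy hz => ?_⟩
  rw [Box.lt_iff] at hxz hzy
  have hzlt := z.lo_lt_hi
  have hPz := PlusAt.of_box hz
  generalize z.lo = p at *
  generalize z.hi = m at *
  by_contra hneg
  rcases lt_trichotomy p i' with hp | hp | hp
  · rcases (by omega : (m = ρ + 1 ∧ a < p) ∨ (y.lo < m ∧ m < ρ + 1) ∨ m = y.lo ∨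
      (i' < m ∧ m < y.lo) ∨ (m = i' ∧ a < p)) with h | h | h | h | h
    · exact hmaxa p (by omega) (by omega) (h.1 ▸ hPz)
    · exact hminq m ⟨h.1, by omega, p, hp, hPz⟩ h.2
    · exact hrow' p hp (h ▸ hPz)
    · exact (hgood m y.hi (by omega) (by omega) le_rfl (by omega)
        (hmaxi' m (by omega) (by omega))).not_plus_row i' p (by omega) (by omega) hPi' hPz
    · exact (hgood p (ρ + 1) (by omega) (by omega) (by omega) (by omega)
        (hmaxa p (by omega) (by omega))).not_plus_below a m (by omega) (by omega) (by omega)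
          hPa hPz
  · subst hp
    rcases (by omega : (ρ + 1 < m ∧ m < y.hi) ∨ m < y.lo) with h | h
    · exact (hgood y.lo m (by omega) le_rfl (by omega) (by omega)
        (hcol m (by omega) (by omega))).not_plus_three a p (ρ + 1) ha hi' hq1 h.1 hPz hPc hPa
    · exact (hgood m y.hi (by omega) (by omega) le_rfl (by omega)
        (hmaxi' m (by omega) (by omega))).not_plus_three a p (ρ + 1) ha hzlt (by omega) hq2
          hPi' hPz hPa
  · rcases (by omega : (m = y.hi ∧ p < y.lo) ∨ (p = y.lo ∧ m < y.hi) ∨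
      (p < y.lo ∧ y.lo < m ∧ m < y.hi) ∨ (p < y.lo ∧ m ≤ y.lo)) with h | h | h | h
    · exact hmaxi' p (by omega) (by omega) (h.1 ▸ hPz)
    · exact hcol m (by omega) (by omega) (h.1 ▸ hPz)
    · exact (hgood y.lo m (by omega) le_rfl (by omega) (by omega)
        (hcol m (by omega) (by omega))).not_plus_row p i' (by omega) (by omega) hPz hPc
    · exact (hgood p y.hi (by omega) (by omega) le_rfl (by omega)
        (hmaxi' p (by omega) (by omega))).not_plus_below i' m (by omega) (by omega) (by omega)
          hPi' hPz

/-- The sum of the ranks of the boxes that contain a `0`. -/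
def zeroWeight (D : Filling n) : ℕ := ∑ b : Box n, if (D b).isZero = true then b.lo + b.hi else 0

/-- A move deletes the `0` in `y`, and at worst puts one into the smaller box `x`. -/
lemma Performs.zeroWeight_lt {O : Set (Box n)} {m : Triple n} {D D' : Filling n} (hxy : m.x < m.y)
    (h : Performs O m D D') : zeroWeight D' < zeroWeight D := by
  obtain ⟨-, hy, -, rfl⟩ := h
  have hmem : m.x ∈ Finset.univ.erase m.y := Finset.mem_erase.2 ⟨hxy.ne, Finset.mem_univ _⟩
  unfold zeroWeight
  rw [← Finset.add_sum_erase _ _ (Finset.mem_univ m.y), ← Finset.add_sum_erase _ _ hmem,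
    ← Finset.add_sum_erase Finset.univ (fun b => if (D b).isZero = true then b.lo + b.hi else 0)
      (Finset.mem_univ m.y),
    ← Finset.add_sum_erase _ (fun b => if (D b).isZero = true then b.lo + b.hi else 0) hmem]
  have hrest : ∑ b ∈ (Finset.univ.erase m.y).erase m.x,
      (if ((Function.update (Function.update D m.y Entry.plus) m.x (D m.x).switch) b).isZero = true
        then b.lo + b.hi else 0) =
      ∑ b ∈ (Finset.univ.erase m.y).erase m.x, if (D b).isZero = true then b.lo + b.hi else 0 := by
    refine Finset.sum_congr rfl fun b hb => ?_
    rw [Finset.mem_erase, Finset.mem_erase] at hb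
    rw [Function.update_of_ne hb.1, Function.update_of_ne hb.2.1]
  rw [hrest, Function.update_of_ne hxy.ne', Function.update_self, Function.update_self, hy]
  rw [Box.lt_iff] at hxy
  rw [if_neg (show ¬ Entry.plus.isZero = true by simp [Entry.isZero]),
    if_pos (show Entry.zero.isZero = true from rfl)]
  split_ifs <;> omega

lemma exists_reaches {O : Set (Box n)} (hO : IsLowerSet O) (D : Filling n) :
    ∃ E, LeConditions O E ∧ Reaches (allMoves n) O D E := by
  induction hw : zeroWeight D using Nat.strong_induction_on generalizing D with
  | _ w ih =>
    subst hw
    by_cases hD : LeConditions O D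
    · exact ⟨D, hD, Relation.ReflTransGen.refl⟩
    · obtain ⟨m, hm, D', hD'⟩ := exists_move hO hD
      obtain ⟨E, hE, hreach⟩ := ih _ (hD'.zeroWeight_lt (lt_of_mem_allMoves hm)) D' rfl
      exact ⟨E, hE, Relation.ReflTransGen.head ⟨m, hm, hD'⟩ hreach⟩

lemma LeConditions.congr {O : Set (Box n)} {D E : Filling n} (hE : LeConditions O E)
    (h : ∀ b ∈ O, D b = E b) : LeConditions O D := by
  refine ⟨?_, ?_, ?_⟩
  · intro c hc a ha h1 h2 h3 h4 b hb h5 h6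
    rw [h _ hb]
    exact hE.cond₁ c hc a ha (h c hc ▸ h1) (h a ha ▸ h2) h3 h4 b hb h5 h6
  · rintro c hc b hb h1 h2 h3 h4 ⟨a, ha, h5, h6⟩
    exact hE.cond₂ c hc b hb (h c hc ▸ h1) (h b hb ▸ h2) h3 h4 ⟨a, ha, h a ha ▸ h5, h6⟩
  · rintro ⟨c, hc, b₁, hb₁, b₂, hb₂, b₃, hb₃, h1, h2, h3, h4, h5⟩
    exact hE.cond₃ ⟨c, hc, b₁, hb₁, b₂, hb₂, b₃, hb₃, h c hc ▸ h1, h _ hb₁ ▸ h2, h _ hb₂ ▸ h3,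
      h _ hb₃ ▸ h4, h5⟩

variable {W : Type*} [Group W] (hn : 3 ≤ n) (cs : CoxeterSystem (typeD n) W)

include hn in
lemma Reaches.diagramProd_eq {O : Set (Box n)} (hO : IsLowerSet O) {e : List (Box n)}
    (he : IsReadingOrder O e) {D E : Filling n} (h : Reaches (allMoves n) O D E) :
    diagramProd cs e E = diagramProd cs e D := by
  induction h with
  | refl => rfl
  | tail _ h ih =>
    obtain ⟨m, hm, h⟩ := h
    rw [h.diagramProd_eq hn cs hO he hm, ih]

include hn in
/-- Moves take `D` to a diagram `E` that satisfies the conditions and has the same product; if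
`𝐯(D)` is positive distinguished, then `D` and `E` agree. -/
lemma isPDS_iff {O : Set (Box n)} (hO : IsLowerSet O) {e : List (Box n)} (he : IsReadingOrder O e)
    (D : Filling n) : IsPDS cs (subexpr e D) ↔ LeConditions O D := by
  refine ⟨fun h => ?_, fun h => h.isPDS hn cs hO he⟩
  obtain ⟨E, hE, hreach⟩ := exists_reaches hO D
  refine hE.congr fun b hb => ?_
  exact IsPDS.eq_of_prod_eq cs h (hE.isPDS hn cs hO he) (hreach.diagramProd_eq hn cs hO he).symm b
    ((he.mem_iff b).2 hb)

include hn in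
lemma isCompleteSystem_allMoves : IsCompleteSystem cs (allMoves n) := by
  refine ⟨fun m hm => isLeMove_of_mem_allMoves hn cs hm, fun O hO D => ?_⟩
  obtain ⟨E, hE, hreach⟩ := exists_reaches hO D
  have hrow := isReadingOrder_rowReading O
  have hLe : IsLeDiagram cs O E := fun e he => hE.isPDS hn cs hO he
  have hprod : elt cs O E = elt cs O D := hreach.diagramProd_eq hn cs hO hrow
  refine ⟨E, ⟨⟨hLe, hprod⟩, fun E' hE' b hb => ?_⟩, hreach⟩
  exact IsPDS.eq_of_prod_eq cs (hE'.1 _ hrow) (hLe _ hrow) (hE'.2.trans hprod.symm) b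
    (mem_rowReading.2 hb)

end Completeness

end LeD

theorem theorem7p1 (n : ℕ) (hn : 4 ≤ n) {W : Type*} [Group W]
    (cs : CoxeterSystem (LeD.typeD n) W) :
    (∀ O : Set (LeD.Box n), IsLowerSet O →
      ∀ e : List (LeD.Box n), LeD.IsReadingOrder O e →
      ∀ D : LeD.Filling n, LeD.IsPDS cs (LeD.subexpr e D) ↔ LeD.LeConditions O D) ∧
    LeD.IsCompleteSystem cs (LeD.moves₀ n ∪ LeD.moves₁ n ∪ LeD.moves₂ n) :=
  ⟨fun _ hO _ he D => LeD.isPDS_iff (by omega) cs hO he D,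
    LeD.isCompleteSystem_allMoves (by omega) cs⟩
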